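/- Throughout, $R$ is a commutative noetherian ring, all modules are finitely generated, and $C$ is a semidualizing $R$-module, i.e. the homothety map $R\to\mathrm{Hom}_R(C,C)$ is an isomorphism and $\mathrm{Ext}^i_R(C,C)=0$ for all $i>0$. Put $(-)^\dagger=\mathrm{Hom}_R(-,C)$. Definitions. Let $n\ge 1$ be an integer and let $M$ be an $R$-module. - The $C$-transpose $\mathrm{Tr}_CM$ is the cokernel of $\partial^\dagger:P_0^\dagger\to P_1^\dagger$, where $P_1\xrightarrow{\partial}P_0\to M\to 0$ is exact with $P_0,P_1$ finitely generated projective; it is unique up to direct summands of finite direct sums of copies of $C$. $M$ is $n$-$C$-torsionfree if $\mathrm{Ext}^i_R(\mathrm{Tr}_CM,C)=0$ for all $1\le i\le n$. - $M$ is an $n$-$C$-syzygy if there is an exact sequence $\sigma: 0\to M\to P_C^1\to\cdots\to P_C^n$ in which every $P_C^i$ is a direct summand of a finite direct sum of copies of $C$ (exactness at $P_C^n$ is not required). If moreover $\sigma$ can be chosen so that the dual sequence $(P_C^n)^\dagger\to\cdots\to(P_C^1)^\dagger\to M^\dagger\to 0$ is exact, then $M$ has an $n$-$C$-universal pushforward.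 - $M$ satisfies $(S_n)$ (resp. $(\widetilde{S_n})$) if $\mathrm{depth}\,M_{\mathfrak p}\ge\min\{n,\dim R_{\mathfrak p}\}$ (resp. $\mathrm{depth}\,M_{\mathfrak p}\ge\min\{n,\mathrm{depth}\,R_{\mathfrak p}\}$) for every prime ideal $\mathfrak p$ of $R$, where $\mathrm{depth}\,0=\infty$; $R$ satisfies $(S_n)$ if it does so as a module over itself. - For $m\ge 0$, $R$ satisfies $(G_m^C)$ if $C_{\mathfrak p}$ has finite injective dimension over $R_{\mathfrak p}$ for every prime ideal $\mathfrak p$ of height at most $m$. - Over any commutative noetherian ring $A$ with a semidualizing module $D$, an $A$-module $N$ is totally $D$-reflexive if the natural map $N\to\mathrm{Hom}_A(\mathrm{Hom}_A(N,D),D)$ is an isomorphism and $\mathrm{Ext}^i_A(N,D)=0=\mathrm{Ext}^i_A(\mathrm{Hom}_A(N,D),D)$ for all $i>0$. Theorem. Let $n\ge 1$, suppose that $R$ satisfies $(S_n)$, and let $M$ be an $R$-module. Assume that either $R$ satisfies $(G_{n-1}^C)$, or $M_{\mathfrak p}$ is totally $C_{\mathfrak p}$-reflexive for every prime ideal $\mathfrak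 p$ of height less than $n$. Then the following conditions are equivalent: 1. $M$ is $n$-$C$-torsionfree; 2. $M$ has an $n$-$C$-universal pushforward; 3. $M$ is an $n$-$C$-syzygy; 4. $M$ satisfies $(\widetilde{S_n})$; 5. $M$ satisfies $(S_n)$. -/

import Mathlib

open CategoryTheory

universe u

namespace RelTorsionfree

section Basic

variable {R : Type u} [CommRing R]

/-- `Ext^i_R(X, Y) = 0`. -/
def ExtVanishes (R : Type u) [CommRing R] (X Y : Type u) [AddCommGroup X] [Module R X]
    [AddCommGroup Y] [Module R Y] (i : ℕ) : Prop :=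
  Subsingleton (Abelian.Ext.{u} (ModuleCat.of R X) (ModuleCat.of R Y) i)

/-- A semidualizing module: a finitely generated module `C` such that the homothety map
`R → Hom_R(C, C)` is an isomorphism and `Ext^i_R(C, C) = 0` for all `i > 0`. -/
structure IsSemidualizing (R : Type u) [CommRing R] (C : Type u) [AddCommGroup C]
    [Module R C] : Prop where
  finite : Module.Finite R C
  homothety_bijective : Function.Bijective (LinearMap.lsmul R C : R → (C →ₗ[R] C))
  ext_vanishes : ∀ i : ℕ, 0 < i → ExtVanishes R C C i

/-- The `C`-dual `f† : Hom_R(Y, C) → Hom_R(X, C)`, `g ↦ g ∘ f`, of a linear map `f : X → Y`. -/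
def cDualMap (C : Type u) [AddCommGroup C] [Module R C] {X Y : Type u} [AddCommGroup X]
    [Module R X] [AddCommGroup Y] [Module R Y] (f : X →ₗ[R] Y) :
    (Y →ₗ[R] C) →ₗ[R] (X →ₗ[R] C) :=
  LinearMap.lcomp R C f

/-- The biduality map `λ_M : M → M††`, `x ↦ (g ↦ g x)`. -/
def biduality (R : Type u) [CommRing R] (C M : Type u) [AddCommGroup C] [Module R C]
    [AddCommGroup M] [Module R M] : M →ₗ[R] ((M →ₗ[R] C) →ₗ[R] C) :=
  LinearMap.applyₗ

/-- `M` is totally `C`-reflexive: `λ_M` is an isomorphism and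
`Ext^i_R(M, C) = 0 = Ext^i_R(M†, C)` for all `i > 0`. -/
structure IsTotallyReflexive (R : Type u) [CommRing R] (C M : Type u) [AddCommGroup C]
    [Module R C] [AddCommGroup M] [Module R M] : Prop where
  biduality_bijective : Function.Bijective (biduality R C M)
  ext_vanishes : ∀ i : ℕ, 0 < i → ExtVanishes R M C i
  ext_dual_vanishes : ∀ i : ℕ, 0 < i → ExtVanishes R (M →ₗ[R] C) C i

/-- The beginning `P₁ → P₀ → M → 0` of a resolution of `M` by finitely generated projective
modules. -/
structure ProjectivePresentation (R : Type u) [CommRing R] (M : Type u) [AddCommGroup M]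
    [Module R M] where
  P₀ : Type u
  P₁ : Type u
  [addCommGroup₀ : AddCommGroup P₀]
  [addCommGroup₁ : AddCommGroup P₁]
  [module₀ : Module R P₀]
  [module₁ : Module R P₁]
  finite₀ : Module.Finite R P₀
  finite₁ : Module.Finite R P₁
  projective₀ : Module.Projective R P₀
  projective₁ : Module.Projective R P₁
  d : P₁ →ₗ[R] P₀
  ε : P₀ →ₗ[R] M
  exact : Function.Exact d ε
  surjective : Function.Surjective ε

attribute [instance] ProjectivePresentation.addCommGroup₀ ProjectivePresentation.addCommGroup₁
  ProjectivePresentation.module₀ ProjectivePresentation.module₁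

/-- The `C`-transpose of `M` computed from a presentation: the cokernel of `d† : P₀† → P₁†`. -/
abbrev ProjectivePresentation.cTranspose (C : Type u) [AddCommGroup C] [Module R C]
    {M : Type u} [AddCommGroup M] [Module R M] (p : ProjectivePresentation R M) : Type u :=
  (p.P₁ →ₗ[R] C) ⧸ LinearMap.range (cDualMap C p.d)

/-- `M` is `n`-`C`-torsionfree: `Ext^i_R(Tr_C M, C) = 0` for all `1 ≤ i ≤ n`. The transpose is
unique up to direct summands of finite direct sums of copies of `C`, so the choice of the
presentation does not matter for semidualizing `C`; we ask for every presentation. -/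
def IsTorsionfree (R : Type u) [CommRing R] (C M : Type u) [AddCommGroup C] [Module R C]
    [AddCommGroup M] [Module R M] (n : ℕ) : Prop :=
  ∀ p : ProjectivePresentation R M, ∀ i : ℕ, 1 ≤ i → i ≤ n → ExtVanishes R (p.cTranspose C) C i

/-- `X` is a direct summand of a finite direct sum of copies of `C`. -/
def IsAddSummand (R : Type u) [CommRing R] (C X : Type u) [AddCommGroup C] [Module R C]
    [AddCommGroup X] [Module R X] : Prop :=
  ∃ (m : ℕ) (s : X →ₗ[R] (Fin m → C)) (r : (Fin m → C) →ₗ[R] X), r ∘ₗ s = LinearMap.id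

/-- An exact sequence `0 → M → P 0 → P 1 → ⋯ → P (n - 1)` whose `n` terms `P i` are direct
summands of finite direct sums of copies of `C`. It is used for `n ≥ 1` only; exactness at the
last term is not required, and the terms `P i` with `i ≥ n` are irrelevant. -/
structure CopresentationBy (R : Type u) [CommRing R] (C M : Type u) [AddCommGroup C]
    [Module R C] [AddCommGroup M] [Module R M] (n : ℕ) where
  P : ℕ → Type u
  [addCommGroup : ∀ i, AddCommGroup (P i)]
  [module : ∀ i, Module R (P i)]
  ι : M →ₗ[R] P 0
  d : ∀ i, P i →ₗ[R] P (i + 1)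
  isAddSummand : ∀ i, i < n → IsAddSummand R C (P i)
  injective : Function.Injective ι
  exact_zero : 2 ≤ n → Function.Exact ι (d 0)
  exact_succ : ∀ i, i + 3 ≤ n → Function.Exact (d i) (d (i + 1))

attribute [instance] CopresentationBy.addCommGroup CopresentationBy.module

/-- `M` is an `n`-`C`-syzygy. -/
def IsSyzygy (R : Type u) [CommRing R] (C M : Type u) [AddCommGroup C] [Module R C]
    [AddCommGroup M] [Module R M] (n : ℕ) : Prop :=
  Nonempty (CopresentationBy R C M n)

/-- The `C`-dual sequence `(P (n - 1))† → ⋯ → (P 1)† → (P 0)† → M† → 0` is exact. -/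
structure CopresentationBy.DualExact {C M : Type u} [AddCommGroup C] [Module R C]
    [AddCommGroup M] [Module R M] {n : ℕ} (σ : CopresentationBy R C M n) : Prop where
  surjective : Function.Surjective (cDualMap C σ.ι)
  exact_zero : 2 ≤ n → Function.Exact (cDualMap C (σ.d 0)) (cDualMap C σ.ι)
  exact_succ : ∀ i, i + 3 ≤ n →
    Function.Exact (cDualMap C (σ.d (i + 1))) (cDualMap C (σ.d i))

/-- `M` has an `n`-`C`-universal pushforward. -/
def HasUniversalPushforward (R : Type u) [CommRing R] (C M : Type u) [AddCommGroup C]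
    [Module R C] [AddCommGroup M] [Module R M] (n : ℕ) : Prop :=
  ∃ σ : CopresentationBy R C M n, σ.DualExact

end Basic

section Depth

open Classical in
/-- The depth of a finitely generated module over a noetherian local ring: the supremum of the
lengths of `M`-regular sequences in the maximal ideal, with `depth 0 = ∞`. -/
noncomputable def depth (A : Type u) [CommRing A] [IsLocalRing A] (N : Type u) [AddCommGroup N]
    [Module A N] : ℕ∞ :=
  if Subsingleton N then ⊤
  else ⨆ rs : {rs : List A // (∀ r ∈ rs, r ∈ IsLocalRing.maximalIdeal A) ∧
    RingTheory.Sequence.IsRegular N rs}, (rs.1.length : ℕ∞)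

/-- Serre's condition `(S_n)`: `depth M_𝔭 ≥ min {n, dim R_𝔭}` for every prime `𝔭` of `R`. -/
def SatisfiesS (R : Type u) [CommRing R] (M : Type u) [AddCommGroup M] [Module R M]
    (n : ℕ) : Prop :=
  ∀ (p : Ideal R) [p.IsPrime],
    min (n : WithBot ℕ∞) (ringKrullDim (Localization.AtPrime p)) ≤
      (depth (Localization.AtPrime p) (LocalizedModule p.primeCompl M) : WithBot ℕ∞)

/-- The condition `(S̃_n)`: `depth M_𝔭 ≥ min {n, depth R_𝔭}` for every prime `𝔭` of `R`. -/
def SatisfiesSTilde (R : Type u) [CommRing R] (M : Type u) [AddCommGroup M] [Module R M]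
    (n : ℕ) : Prop :=
  ∀ (p : Ideal R) [p.IsPrime],
    min (n : ℕ∞) (depth (Localization.AtPrime p) (Localization.AtPrime p)) ≤
      depth (Localization.AtPrime p) (LocalizedModule p.primeCompl M)

/-- The condition `(G_n^C)`: `C_𝔭` has finite injective dimension over `R_𝔭` for every prime
`𝔭` of height at most `n`. -/
def SatisfiesG (R : Type u) [CommRing R] (C : Type u) [AddCommGroup C] [Module R C]
    (n : ℕ) : Prop :=
  ∀ (p : Ideal R) [p.IsPrime], p.height ≤ (n : ℕ∞) →
    injectiveDimension
      (ModuleCat.of (Localization.AtPrime p) (LocalizedModule p.primeCompl C)) < ⊤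

end Depth

end RelTorsionfree

/-! The transpose can be eliminated. The sequence 0 → Ext¹(Tr M, C) → M → M†† → Ext²(Tr M, C) → 0,
together with Ext^{i+2}(Tr M, C) ≅ Ext^i(M†, C) for i ≥ 1, turns `n`-`C`-torsionfreeness into
conditions on the biduality map λ_M and on M† (`IsBidualTorsionfree`,
`isTorsionfree_iff_isBidualTorsionfree`).

The engine is the pushforward: a short exact sequence 0 → M → Y → Z → 0 with Y totally reflexive and
Y† → M† surjective. Dualizing it shows that M is (n+1)-torsionfree iff Z is n-torsionfree
(`isBidualTorsionfree_succ_iff`). Generators of M† are the coordinates of a map M → C^m with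
surjective dual, injective exactly when λ_M is, so iteration gives 1 → 2; forgetting dual exactness
gives 2 → 3.

For 3 → 4, the depth lemma runs along the localized syzygy sequence, given depth C_𝔭 ≥ depth R_𝔭
(`IsSemidualizing.extDepthGE`). This holds because R = Hom(C, C) and C has no self-extensions, so
that regular sequences pass from Hom(C, C) to C. Condition (S_n) on R gives 4 → 5.

For 5 → 1 (`isBidualTorsionfree_of_localizedModule`), push M forward into C^m. The kernel is zero
because it has no associated prime: where the height is less than n, M_𝔭 is totally reflexive, and
elsewhere M_𝔭 has positive depth. The cokernel stays totally reflexive at small heights and loses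
one unit of depth at large ones, so the argument repeats. Under (G_{n-1}^C) reflexivity at height
less than n comes from depth M_𝔭 ≥ dim R_𝔭 and finite injective dimension of C_𝔭
(`isTotallyReflexive_of_ringKrullDim_le_depth`). -/

namespace RelTorsionfree

/-! ### Vanishing of Ext along short exact sequences -/

section ExtVanishing

open Abelian

variable {R : Type u} [CommRing R]
  {X Y Z N K : Type u} [AddCommGroup X] [Module R X] [AddCommGroup Y] [Module R Y]
  [AddCommGroup Z] [Module R Z] [AddCommGroup N] [Module R N] [AddCommGroup K] [Module R K]

/-- The short complex of modules attached to two composable linear maps. -/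
abbrev shortComplexOfExact (f : X →ₗ[R] Y) (g : Y →ₗ[R] Z) (hfg : Function.Exact f g) :
    ShortComplex (ModuleCat.{u} R) :=
  ShortComplex.mk (ModuleCat.ofHom f) (ModuleCat.ofHom g)
    (by rw [← ModuleCat.ofHom_comp, hfg.linearMap_comp_eq_zero]; rfl)

lemma shortExact_shortComplexOfExact {f : X →ₗ[R] Y} {g : Y →ₗ[R] Z}
    (hf : Function.Injective f) (hfg : Function.Exact f g) (hg : Function.Surjective g) :
    (shortComplexOfExact f g hfg).ShortExact :=
  ModuleCat.shortComplex_shortExact _ hfg hf hg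

lemma extVanishes_iff {i : ℕ} :
    ExtVanishes R X N i ↔ ∀ e : Ext.{u} (ModuleCat.of R X) (ModuleCat.of R N) i, e = 0 :=
  ⟨fun h e ↦ h.elim e 0, fun h ↦ ⟨fun a b ↦ (h a).trans (h b).symm⟩⟩

lemma extVanishes_zero_iff : ExtVanishes R X N 0 ↔ Subsingleton (X →ₗ[R] N) :=
  (Ext.addEquiv₀.trans ModuleCat.homAddEquiv).subsingleton_congr

lemma extVanishes_of_projective [Module.Projective R X] {i : ℕ} (hi : 0 < i) :
    ExtVanishes R X N i := by
  obtain ⟨j, rfl⟩ := Nat.exists_eq_succ_of_ne_zero hi.ne'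
  have : Projective (ModuleCat.of R X) := (IsProjective.iff_projective X).mp inferInstance
  exact extVanishes_iff.2 fun e ↦ Ext.eq_zero_of_projective e

lemma ExtVanishes.retract_left {i : ℕ} (s : X →ₗ[R] Y) (r : Y →ₗ[R] X)
    (hrs : r ∘ₗ s = LinearMap.id) (h : ExtVanishes R Y N i) : ExtVanishes R X N i := by
  refine extVanishes_iff.2 fun e ↦ ?_
  have h1 := extVanishes_iff.1 h ((Ext.mk₀ (ModuleCat.ofHom r)).comp e (zero_add i))
  have h2 : (Ext.mk₀ (ModuleCat.ofHom s)).comp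
      ((Ext.mk₀ (ModuleCat.ofHom r)).comp e (zero_add i)) (zero_add i) = e := by
    rw [Ext.mk₀_comp_mk₀_assoc, ← ModuleCat.ofHom_comp, hrs]
    exact Ext.mk₀_id_comp e
  rw [← h2, h1, Ext.comp_zero]

lemma ExtVanishes.retract_right {i : ℕ} (s : X →ₗ[R] Y) (r : Y →ₗ[R] X)
    (hrs : r ∘ₗ s = LinearMap.id) (h : ExtVanishes R K Y i) : ExtVanishes R K X i := by
  refine extVanishes_iff.2 fun e ↦ ?_
  have h1 := extVanishes_iff.1 h (e.comp (Ext.mk₀ (ModuleCat.ofHom s)) (add_zero i))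
  have h2 : (e.comp (Ext.mk₀ (ModuleCat.ofHom s)) (add_zero i)).comp
      (Ext.mk₀ (ModuleCat.ofHom r)) (add_zero i) = e := by
    rw [Ext.comp_assoc_of_third_deg_zero, Ext.mk₀_comp_mk₀, ← ModuleCat.ofHom_comp, hrs]
    exact Ext.comp_mk₀_id e
  rw [← h2, h1, Ext.zero_comp]

lemma ExtVanishes.congr_left {i : ℕ} (e : X ≃ₗ[R] Y) (h : ExtVanishes R Y N i) :
    ExtVanishes R X N i :=
  h.retract_left e.toLinearMap e.symm.toLinearMap (by ext; simp)

section ShortExact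

variable {f : X →ₗ[R] Y} {g : Y →ₗ[R] Z} (hf : Function.Injective f)
  (hfg : Function.Exact f g) (hg : Function.Surjective g) {i : ℕ}
include hf hfg hg

lemma extVanishes_middle_left (h₁ : ExtVanishes R X N i) (h₃ : ExtVanishes R Z N i) :
    ExtVanishes R Y N i := by
  refine extVanishes_iff.2 fun e ↦ ?_
  obtain ⟨a, rfl⟩ := Ext.contravariant_sequence_exact₂
    (shortExact_shortComplexOfExact hf hfg hg) _ e (extVanishes_iff.1 h₁ _)
  rw [extVanishes_iff.1 h₃ a, Ext.comp_zero]

lemma extVanishes_sub_left (h₂ : ExtVanishes R Y N i) (h₃ : ExtVanishes R Z N (i + 1)) :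
    ExtVanishes R X N i := by
  refine extVanishes_iff.2 fun e ↦ ?_
  obtain ⟨a, rfl⟩ := Ext.contravariant_sequence_exact₁
    (shortExact_shortComplexOfExact hf hfg hg) _ e (add_comm 1 i) (extVanishes_iff.1 h₃ _)
  rw [extVanishes_iff.1 h₂ a, Ext.comp_zero]

lemma extVanishes_quot_left (h₁ : ExtVanishes R X N i) (h₂ : ExtVanishes R Y N (i + 1)) :
    ExtVanishes R Z N (i + 1) := by
  refine extVanishes_iff.2 fun e ↦ ?_
  obtain ⟨a, rfl⟩ := Ext.contravariant_sequence_exact₃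
    (shortExact_shortComplexOfExact hf hfg hg) _ e (extVanishes_iff.1 h₂ _) (add_comm 1 i)
  rw [extVanishes_iff.1 h₁ a, Ext.comp_zero]

lemma extVanishes_middle_right (h₁ : ExtVanishes R K X i) (h₃ : ExtVanishes R K Z i) :
    ExtVanishes R K Y i := by
  refine extVanishes_iff.2 fun e ↦ ?_
  obtain ⟨a, rfl⟩ := Ext.covariant_sequence_exact₂ _
    (shortExact_shortComplexOfExact hf hfg hg) e (extVanishes_iff.1 h₃ _)
  rw [extVanishes_iff.1 h₁ a, Ext.zero_comp]

lemma extVanishes_sub_right (h₃ : ExtVanishes R K Z i) (h₂ : ExtVanishes R K Y (i + 1)) :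
    ExtVanishes R K X (i + 1) := by
  refine extVanishes_iff.2 fun e ↦ ?_
  obtain ⟨a, rfl⟩ := Ext.covariant_sequence_exact₁ _
    (shortExact_shortComplexOfExact hf hfg hg) e (extVanishes_iff.1 h₂ _) rfl
  rw [extVanishes_iff.1 h₃ a, Ext.zero_comp]

lemma extVanishes_quot_right (h₂ : ExtVanishes R K Y i) (h₁ : ExtVanishes R K X (i + 1)) :
    ExtVanishes R K Z i := by
  refine extVanishes_iff.2 fun e ↦ ?_
  obtain ⟨a, rfl⟩ := Ext.covariant_sequence_exact₃ _
    (shortExact_shortComplexOfExact hf hfg hg) e rfl (extVanishes_iff.1 h₁ _)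
  rw [extVanishes_iff.1 h₂ a, Ext.zero_comp]

lemma surjective_cDualMap_of_extVanishes (h : ExtVanishes R Z N 1) :
    Function.Surjective (cDualMap N f) := by
  intro φ
  obtain ⟨a, ha⟩ := Ext.contravariant_sequence_exact₁
    (shortExact_shortComplexOfExact hf hfg hg) (ModuleCat.of R N)
    (Ext.mk₀ (ModuleCat.ofHom φ)) (add_zero 1) (extVanishes_iff.1 h _)
  obtain ⟨b, rfl⟩ := Ext.addEquiv₀.symm.surjective a
  refine ⟨b.hom, ?_⟩
  simp only [Ext.addEquiv₀_symm_apply, Ext.mk₀_comp_mk₀] at ha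
  have := Ext.addEquiv₀.symm.injective ha
  exact congrArg ModuleCat.Hom.hom this

/-- When Ext¹(Y, N) = 0, the group Ext¹(Z, N) is the cokernel of f†. This and the preceding lemma
let Ext¹ be handled as an extension problem for linear maps. -/
lemma extVanishes_one_of_surjective_cDualMap (h : Function.Surjective (cDualMap N f))
    (h₂ : ExtVanishes R Y N 1) : ExtVanishes R Z N 1 := by
  refine extVanishes_iff.2 fun e ↦ ?_
  have hS := shortExact_shortComplexOfExact hf hfg hg
  obtain ⟨a, rfl⟩ := Ext.contravariant_sequence_exact₃ hS _ e (extVanishes_iff.1 h₂ _) (add_zero 1)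
  obtain ⟨b, rfl⟩ := Ext.addEquiv₀.symm.surjective a
  obtain ⟨φ, hφ⟩ := h b.hom
  have : b = ModuleCat.ofHom f ≫ ModuleCat.ofHom φ := by
    ext x
    exact (DFunLike.congr_fun hφ x).symm
  -- The class is the image of `b` under the connecting map; `b` factors through `f`, and the
  -- extension class composed with `f` is zero.
  rw [this, Ext.addEquiv₀_symm_apply, ← Ext.mk₀_comp_mk₀]
  exact hS.extClass_comp_assoc _

end ShortExact

lemma extVanishes_of_subsingleton_left [Subsingleton X] (i : ℕ) : ExtVanishes R X N i := by
  refine extVanishes_iff.2 fun e ↦ ?_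
  rw [← Ext.mk₀_id_comp e, (ModuleCat.isZero_of_subsingleton (ModuleCat.of R X)).eq_of_src (𝟙 _) 0,
    Ext.mk₀_zero, Ext.zero_comp]

lemma extVanishes_of_subsingleton_right [Subsingleton N] (i : ℕ) : ExtVanishes R X N i := by
  refine extVanishes_iff.2 fun e ↦ ?_
  rw [← Ext.comp_mk₀_id e, (ModuleCat.isZero_of_subsingleton (ModuleCat.of R N)).eq_of_src (𝟙 _) 0,
    Ext.mk₀_zero, Ext.comp_zero]

variable (R X) in
/-- The inclusion of the first coordinate of `X ^ (m + 1)`. -/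
def consZero (m : ℕ) : X →ₗ[R] (Fin (m + 1) → X) := LinearMap.single R (fun _ ↦ X) 0

variable (R X) in
/-- Forgetting the first coordinate of `X ^ (m + 1)`. -/
def finTail (m : ℕ) : (Fin (m + 1) → X) →ₗ[R] (Fin m → X) := LinearMap.funLeft R X Fin.succ

lemma injective_consZero (m : ℕ) : Function.Injective (consZero R X m) :=
  Pi.single_injective (M := fun _ : Fin (m + 1) ↦ X) 0

lemma exact_consZero_finTail (m : ℕ) : Function.Exact (consZero R X m) (finTail R X m) := by
  intro v
  constructor
  · intro h
    refine ⟨v 0, funext fun j ↦ ?_⟩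
    refine Fin.cases ?_ (fun j ↦ ?_) j
    · simp [consZero]
    · simpa [consZero, finTail, LinearMap.funLeft] using (congrFun h j).symm
  · rintro ⟨x, rfl⟩
    ext j
    simp [consZero, finTail, LinearMap.funLeft]

lemma surjective_finTail (m : ℕ) : Function.Surjective (finTail R X m) :=
  LinearMap.funLeft_surjective_of_injective R X _ (Fin.succ_injective m)

lemma ExtVanishes.pi_left {i : ℕ} (h : ExtVanishes R X N i) (m : ℕ) :
    ExtVanishes R (Fin m → X) N i := by
  induction m with
  | zero => exact extVanishes_of_subsingleton_left i
  | succ m ih =>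
    exact extVanishes_middle_left (injective_consZero m) (exact_consZero_finTail m)
      (surjective_finTail m) h ih

lemma ExtVanishes.pi_right {i : ℕ} (h : ExtVanishes R K X i) (m : ℕ) :
    ExtVanishes R K (Fin m → X) i := by
  induction m with
  | zero => exact extVanishes_of_subsingleton_right i
  | succ m ih =>
    exact extVanishes_middle_right (injective_consZero m) (exact_consZero_finTail m)
      (surjective_finTail m) h ih

lemma IsAddSummand.extVanishes_right {i : ℕ} (hX : IsAddSummand R Y X)
    (h : ExtVanishes R K Y i) : ExtVanishes R K X i := by
  obtain ⟨m, s, r, hrs⟩ := hX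
  exact (h.pi_right m).retract_right s r hrs

lemma IsAddSummand.extVanishes_left {i : ℕ} (hX : IsAddSummand R Y X)
    (h : ExtVanishes R Y N i) : ExtVanishes R X N i := by
  obtain ⟨m, s, r, hrs⟩ := hX
  exact (h.pi_left m).retract_left s r hrs

/-- If `x` is a nonzerodivisor on `X` lying in the maximal ideal, then vanishing of
`Ext^{i+1}(X/xX, N)` forces `Ext^i(X, N) = 0` by Nakayama. -/
lemma extVanishes_of_extVanishes_quotient_smul [IsLocalRing R] [IsNoetherianRing R]
    [Module.Finite R X] [Module.Finite R N] {x : R} (hx : x ∈ IsLocalRing.maximalIdeal R)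
    (hreg : IsSMulRegular X x) {g : X →ₗ[R] Z}
    (hfg : Function.Exact (LinearMap.lsmul R X x) g) (hg : Function.Surjective g) {i : ℕ}
    (h : ExtVanishes R Z N (i + 1)) : ExtVanishes R X N i := by
  have hS := shortExact_shortComplexOfExact (f := LinearMap.lsmul R X x) hreg hfg hg
  -- The connecting map lands in Ext^{i+1}(Z, N) = 0, so multiplication by `x` is onto.
  have key : ∀ e : Ext.{u} (ModuleCat.of R X) (ModuleCat.of R N) i,
      ∃ e' : Ext.{u} (ModuleCat.of R X) (ModuleCat.of R N) i, e = x • e' := by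
    intro e
    obtain ⟨e', rfl⟩ := Ext.contravariant_sequence_exact₁ hS _ e (add_comm 1 i)
      (extVanishes_iff.1 h _)
    refine ⟨e', ?_⟩
    have : (shortComplexOfExact _ g hfg).f = x • 𝟙 (ModuleCat.of R X) := rfl
    rw [this, Ext.mk₀_smul, Ext.smul_comp, Ext.mk₀_id_comp]
  have htop : (⊤ : Submodule R (Ext.{u} (ModuleCat.of R X) (ModuleCat.of R N) i)) = ⊥ := by
    refine Submodule.eq_bot_of_le_smul_of_le_jacobson_bot (IsLocalRing.maximalIdeal R) _
      (Module.finite_def.1 inferInstance) ?_ (IsLocalRing.maximalIdeal_le_jacobson _)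
    intro e _
    obtain ⟨e', rfl⟩ := key e
    exact Submodule.smul_mem_smul hx trivial
  exact extVanishes_iff.2 fun e ↦ (Submodule.mem_bot R).1 (htop ▸ trivial)

end ExtVanishing

/-! ### Biduality and totally reflexive modules -/

section Duality

variable {R : Type u} [CommRing R] {C : Type u} [AddCommGroup C] [Module R C]
  {X Y Z : Type u} [AddCommGroup X] [Module R X] [AddCommGroup Y] [Module R Y]
  [AddCommGroup Z] [Module R Z]

lemma cDualMap_apply (f : X →ₗ[R] Y) (φ : Y →ₗ[R] C) : cDualMap C f φ = φ ∘ₗ f := rfl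

lemma cDualMap_comp (f : X →ₗ[R] Y) (g : Y →ₗ[R] Z) :
    cDualMap C (g ∘ₗ f) = cDualMap C f ∘ₗ cDualMap C g := rfl

lemma biduality_apply (x : X) (φ : X →ₗ[R] C) : biduality R C X x φ = φ x := rfl

lemma cDualMap_cDualMap_biduality (f : X →ₗ[R] Y) (x : X) :
    cDualMap C (cDualMap C f) (biduality R C X x) = biduality R C Y (f x) := rfl

lemma injective_cDualMap {g : Y →ₗ[R] Z} (hg : Function.Surjective g) :
    Function.Injective (cDualMap C g) := by
  intro φ ψ h
  ext z
  obtain ⟨y, rfl⟩ := hg z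
  exact DFunLike.congr_fun h y

lemma exact_cDualMap {f : X →ₗ[R] Y} {g : Y →ₗ[R] Z} (hfg : Function.Exact f g)
    (hg : Function.Surjective g) : Function.Exact (cDualMap C g) (cDualMap C f) := by
  intro φ
  constructor
  · intro h
    have hk : LinearMap.ker g ≤ LinearMap.ker φ := by
      intro y hy
      obtain ⟨x, rfl⟩ := (hfg y).1 hy
      exact DFunLike.congr_fun h x
    refine ⟨(LinearMap.ker g).liftQ φ hk ∘ₗ
      (g.quotKerEquivOfSurjective hg).symm.toLinearMap, ?_⟩
    ext y
    have : (g.quotKerEquivOfSurjective hg).symm (g y) = (LinearMap.ker g).mkQ y := by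
      rw [LinearEquiv.symm_apply_eq]; rfl
    simp [cDualMap_apply, this]
  · rintro ⟨ψ, rfl⟩
    ext x
    simp [cDualMap_apply, hfg.apply_apply_eq_zero]

lemma bijective_biduality_of_retract (s : X →ₗ[R] Y) (r : Y →ₗ[R] X)
    (hrs : r ∘ₗ s = LinearMap.id) (h : Function.Bijective (biduality R C Y)) :
    Function.Bijective (biduality R C X) := by
  have hrs' : ∀ x, r (s x) = x := DFunLike.congr_fun hrs
  constructor
  · intro a b hab
    have := congrArg (cDualMap C (cDualMap C s)) hab
    rw [cDualMap_cDualMap_biduality, cDualMap_cDualMap_biduality] at this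
    rw [← hrs' a, ← hrs' b, h.1 this]
  · intro φ
    obtain ⟨y, hy⟩ := h.2 (cDualMap C (cDualMap C s) φ)
    refine ⟨r y, ?_⟩
    rw [← cDualMap_cDualMap_biduality, hy, ← LinearMap.comp_apply, ← cDualMap_comp,
      ← cDualMap_comp, hrs]
    rfl

lemma bijective_biduality_pi (h : Function.Bijective (biduality R C X)) (m : ℕ) :
    Function.Bijective (biduality R C (Fin m → X)) := by
  constructor
  · intro a b hab
    funext j
    exact h.1 (congrArg (cDualMap C (cDualMap C
      (LinearMap.proj (R := R) (φ := fun _ : Fin m ↦ X) j))) hab)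
  · intro φ
    choose v hv using fun j ↦ h.2 (cDualMap C (cDualMap C
      (LinearMap.proj (R := R) (φ := fun _ : Fin m ↦ X) j)) φ)
    refine ⟨v, ?_⟩
    ext g
    have hg : g = ∑ j, (g ∘ₗ LinearMap.single R (fun _ ↦ X) j) ∘ₗ LinearMap.proj j := by
      rw [← LinearMap.lsum_apply R (fun _ : Fin m ↦ X) R]
      refine LinearMap.pi_ext fun j x ↦ ?_
      rw [LinearMap.lsum_piSingle]
      rfl
    rw [hg, map_sum, map_sum]
    refine Finset.sum_congr rfl fun j _ ↦ ?_
    exact DFunLike.congr_fun (hv j) (g ∘ₗ LinearMap.single R (fun _ ↦ X) j)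

lemma IsTotallyReflexive.of_isAddSummand (hX : IsTotallyReflexive R C X)
    (hY : IsAddSummand R X Y) : IsTotallyReflexive R C Y := by
  obtain ⟨m, s, r, hrs⟩ := id hY
  refine ⟨bijective_biduality_of_retract s r hrs (bijective_biduality_pi hX.1 m),
    fun i hi ↦ hY.extVanishes_left (hX.2 i hi), fun i hi ↦ ?_⟩
  have h := (hX.3 i hi).pi_left m
  have h2 := h.congr_left (LinearMap.lsum R (fun _ : Fin m ↦ X) R (M := C)).symm
  refine h2.retract_left (cDualMap C r) (cDualMap C s) ?_
  rw [← cDualMap_comp, hrs]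
  rfl

lemma isAddSummand_pi (m : ℕ) : IsAddSummand R X (Fin m → X) :=
  ⟨m, LinearMap.id, LinearMap.id, rfl⟩

lemma isAddSummand_of_projective [Module.Finite R X] [Module.Projective R X] :
    IsAddSummand R R X := by
  obtain ⟨m, r, hr⟩ := Module.Finite.exists_fin' R X
  obtain ⟨s, hs⟩ := Module.projective_lifting_property r LinearMap.id hr
  exact ⟨m, s, r, hs⟩

/-- The homothety map as a linear equivalence `R ≃ C†`. -/
noncomputable def IsSemidualizing.homothetyEquiv (hC : IsSemidualizing R C) :
    R ≃ₗ[R] (C →ₗ[R] C) :=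
  LinearEquiv.ofBijective (LinearMap.lsmul R C : R →ₗ[R] C →ₗ[R] C) hC.homothety_bijective

lemma IsSemidualizing.isTotallyReflexive_self (hC : IsSemidualizing R C) :
    IsTotallyReflexive R C C := by
  -- C† is generated by the identity, so a functional on C† is evaluation at its value on
  -- `LinearMap.id`.
  refine ⟨⟨fun a b h ↦ DFunLike.congr_fun h LinearMap.id, fun φ ↦ ⟨φ LinearMap.id, ?_⟩⟩,
    hC.ext_vanishes, fun i hi ↦ ?_⟩
  · ext g
    obtain ⟨a, rfl⟩ := hC.homothety_bijective.2 g
    have : LinearMap.lsmul R C a = a • LinearMap.id := rfl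
    rw [this, map_smul, map_smul]
    rfl
  · exact (extVanishes_of_projective (X := R) hi).congr_left hC.homothetyEquiv.symm

lemma IsSemidualizing.isTotallyReflexive_ring (hC : IsSemidualizing R C) :
    IsTotallyReflexive R C R := by
  refine ⟨⟨fun a b h ↦ hC.homothety_bijective.1 ?_, fun φ ↦ ?_⟩,
    fun i hi ↦ extVanishes_of_projective hi, fun i hi ↦ ?_⟩
  · ext c
    have := DFunLike.congr_fun h (LinearMap.toSpanSingleton R C c)
    simpa [biduality_apply] using this
  -- Under Hom(R, C) ≅ C, an element of R†† becomes an endomorphism of C, hence a homothety.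
  · obtain ⟨a, ha⟩ := hC.homothety_bijective.2
      (φ ∘ₗ (LinearMap.ringLmapEquivSelf R R C).symm.toLinearMap)
    refine ⟨a, ?_⟩
    ext g
    have := DFunLike.congr_fun ha (g 1)
    have hg : (LinearMap.ringLmapEquivSelf R R C).symm (g 1) = g := by
      rw [LinearEquiv.symm_apply_eq]; rfl
    rw [LinearMap.comp_apply, LinearEquiv.coe_coe, hg] at this
    rw [← this, biduality_apply, LinearMap.lsmul_apply, ← map_smul, smul_eq_mul, mul_one]
  · exact (hC.ext_vanishes i hi).congr_left (LinearMap.ringLmapEquivSelf R R C)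

lemma IsSemidualizing.isTotallyReflexive_of_isAddSummand (hC : IsSemidualizing R C)
    (hX : IsAddSummand R C X) : IsTotallyReflexive R C X :=
  hC.isTotallyReflexive_self.of_isAddSummand hX

lemma IsSemidualizing.isTotallyReflexive_of_projective (hC : IsSemidualizing R C)
    [Module.Finite R X] [Module.Projective R X] : IsTotallyReflexive R C X :=
  hC.isTotallyReflexive_ring.of_isAddSummand isAddSummand_of_projective

/-- An intrinsic form of `n`-`C`-torsionfreeness: conditions on the biduality map of `M` and on
`Ext(M†, C)`. -/
structure IsBidualTorsionfree (R : Type u) [CommRing R] (C M : Type u) [AddCommGroup C]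
    [Module R C] [AddCommGroup M] [Module R M] (n : ℕ) : Prop where
  injective : 1 ≤ n → Function.Injective (biduality R C M)
  surjective : 2 ≤ n → Function.Surjective (biduality R C M)
  ext_dual_vanishes : ∀ i, 1 ≤ i → i + 2 ≤ n → ExtVanishes R (M →ₗ[R] C) C i

/-- In the naturality square f†† ∘ λ_X = λ_Y ∘ f, both f†† and λ_Y are injective. -/
lemma injective_biduality_iff_of_surjective_cDualMap {f : X →ₗ[R] Y}
    (hf : Function.Surjective (cDualMap C f)) (hY : Function.Injective (biduality R C Y)) :
    Function.Injective (biduality R C X) ↔ Function.Injective f := by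
  have h : ⇑(cDualMap C (cDualMap C f)) ∘ biduality R C X = biduality R C Y ∘ f := rfl
  rw [← (injective_cDualMap hf).of_comp_iff, h, hY.of_comp_iff]

/-! ### Exact sequences whose C-dual is exact -/

section Pushforward

variable {f : X →ₗ[R] Y} {g : Y →ₗ[R] Z} (hY : IsTotallyReflexive R C Y)
  (hfd : Function.Surjective (cDualMap C f)) (hf : Function.Injective f)
  (hfg : Function.Exact f g) (hg : Function.Surjective g)
include hY hfd hfg hg

/-- Dimension shift along 0 → Z† → Y† → X† → 0, whose middle term has no higher Ext into C. -/
lemma extVanishes_dual_iff_succ {i : ℕ} (hi : 1 ≤ i) :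
    ExtVanishes R (Z →ₗ[R] C) C i ↔ ExtVanishes R (X →ₗ[R] C) C (i + 1) :=
  ⟨fun h ↦ extVanishes_quot_left (injective_cDualMap hg) (exact_cDualMap hfg hg) hfd h
      (hY.ext_dual_vanishes _ (Nat.succ_pos _)),
    fun h ↦ extVanishes_sub_left (injective_cDualMap hg) (exact_cDualMap hfg hg) hfd
      (hY.ext_dual_vanishes _ hi) h⟩

/-- Since λ_Z ∘ g = g†† ∘ λ_Y with g surjective and λ_Y bijective, the cokernel of λ_Z is that of
g††, which is Ext¹(X†, C). -/
lemma surjective_biduality_iff_extVanishes_one :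
    Function.Surjective (biduality R C Z) ↔ ExtVanishes R (X →ₗ[R] C) C 1 := by
  have h : ⇑(cDualMap C (cDualMap C g)) ∘ biduality R C Y = biduality R C Z ∘ g := rfl
  have h' : Function.Surjective (biduality R C Z) ↔
      Function.Surjective (cDualMap C (cDualMap C g)) := by
    rw [← hg.of_comp_iff, ← h]
    exact ⟨fun h ↦ h.of_comp, fun h ↦ h.comp hY.biduality_bijective.2⟩
  rw [h']
  exact ⟨fun h ↦ extVanishes_one_of_surjective_cDualMap (injective_cDualMap hg)
      (exact_cDualMap hfg hg) hfd h (hY.ext_dual_vanishes 1 one_pos),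
    fun h ↦ surjective_cDualMap_of_extVanishes (injective_cDualMap hg)
      (exact_cDualMap hfg hg) hfd h⟩

/-- A diagram chase between X → Y → Z → 0 and the exact sequence 0 → X†† → Y†† → Z††, with λ_Y
bijective. -/
lemma injective_biduality_iff_surjective_biduality :
    Function.Injective (biduality R C Z) ↔ Function.Surjective (biduality R C X) := by
  have hex := exact_cDualMap (C := C) (exact_cDualMap (C := C) hfg hg) hfd
  constructor
  · intro h φ
    obtain ⟨y, hy⟩ := hY.biduality_bijective.2 (cDualMap C (cDualMap C f) φ)
    have h0 : biduality R C Z (g y) = 0 := by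
      rw [← cDualMap_cDualMap_biduality, hy]
      exact hex.apply_apply_eq_zero φ
    obtain ⟨x, rfl⟩ := (hfg y).1 (h (h0.trans (map_zero _).symm))
    exact ⟨x, injective_cDualMap hfd hy⟩
  · intro h
    rw [injective_iff_map_eq_zero]
    intro z hz
    obtain ⟨y, rfl⟩ := hg z
    rw [← cDualMap_cDualMap_biduality] at hz
    obtain ⟨φ, hφ⟩ := (hex _).1 hz
    obtain ⟨x, rfl⟩ := h φ
    rw [cDualMap_cDualMap_biduality] at hφ
    rw [← hY.biduality_bijective.1 hφ, hfg.apply_apply_eq_zero]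

include hf

/-- Each condition on Z is the next one on X: injectivity of λ_Z is surjectivity of λ_X,
surjectivity of λ_Z is Ext¹(X†, C) = 0, and Ext shifts by one. Injectivity of λ_X is automatic
because f is injective. -/
lemma isBidualTorsionfree_succ_iff (n : ℕ) :
    IsBidualTorsionfree R C X (n + 1) ↔ IsBidualTorsionfree R C Z n := by
  have h1 := (injective_biduality_iff_of_surjective_cDualMap hfd hY.biduality_bijective.1).2 hf
  have h2 := injective_biduality_iff_surjective_biduality hY hfd hfg hg
  have h3 := surjective_biduality_iff_extVanishes_one hY hfd hfg hg
  constructor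
  · intro h
    exact ⟨fun hn ↦ h2.2 (h.2 (by lia)), fun hn ↦ h3.2 (h.3 1 le_rfl (by lia)),
      fun i hi hn ↦ (extVanishes_dual_iff_succ hY hfd hfg hg hi).2 (h.3 _ (by lia) (by lia))⟩
  · intro h
    refine ⟨fun _ ↦ h1, fun hn ↦ h2.1 (h.1 (by lia)), fun i hi hn ↦ ?_⟩
    obtain rfl | ⟨j, hj, rfl⟩ : i = 1 ∨ ∃ j, 1 ≤ j ∧ i = j + 1 := by
      rcases Nat.lt_or_ge 1 i with h | h
      · exact Or.inr ⟨i - 1, by lia, by lia⟩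
      · exact Or.inl (by lia)
    · exact h3.1 (h.2 (by lia))
    · exact (extVanishes_dual_iff_succ hY hfd hfg hg hj).1 (h.3 _ hj (by lia))

/-- Only Ext¹(Z, C) = 0 is not a plain dimension shift; it is the surjectivity of f†. -/
lemma IsTotallyReflexive.quotient (hX : IsTotallyReflexive R C X) :
    IsTotallyReflexive R C Z := by
  refine ⟨⟨?_, ?_⟩, fun i hi ↦ ?_, fun i hi ↦ ?_⟩
  · exact (injective_biduality_iff_surjective_biduality hY hfd hfg hg).2 hX.biduality_bijective.2
  · exact (surjective_biduality_iff_extVanishes_one hY hfd hfg hg).2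
      (hX.ext_dual_vanishes 1 one_pos)
  · obtain ⟨j, rfl⟩ := Nat.exists_eq_succ_of_ne_zero hi.ne'
    rcases j with _ | j
    · exact extVanishes_one_of_surjective_cDualMap hf hfg hg hfd (hY.ext_vanishes 1 one_pos)
    · exact extVanishes_quot_left hf hfg hg (hX.ext_vanishes _ (Nat.succ_pos _))
        (hY.ext_vanishes _ hi)
  · exact (extVanishes_dual_iff_succ hY hfd hfg hg hi).2 (hX.ext_dual_vanishes _ (Nat.succ_pos _))

end Pushforward

end Duality

/-! ### The C-transpose and torsionfreeness -/

section Transpose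

variable {R : Type u} [CommRing R] {C : Type u} [AddCommGroup C] [Module R C]
  {M : Type u} [AddCommGroup M] [Module R M]

/-- With B the image of d†, the sequences 0 → M† → P₀† → B → 0 and 0 → B → P₁† → Tr M → 0 have
middle terms without higher Ext into C. Two shifts identify Ext^{i+2}(Tr M, C) with Ext^i(M†, C);
degrees 1 and 2 measure the kernel and cokernel of λ_M. The right side is thus independent of the
presentation. -/
lemma isBidualTorsionfree_iff_extVanishes_cTranspose (hC : IsSemidualizing R C)
    (p : ProjectivePresentation R M) (n : ℕ) :
    IsBidualTorsionfree R C M n ↔ ∀ i, 1 ≤ i → i ≤ n → ExtVanishes R (p.cTranspose C) C i := by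
  have := p.finite₀
  have := p.finite₁
  have := p.projective₀
  have := p.projective₁
  have h0 : IsTotallyReflexive R C p.P₀ := hC.isTotallyReflexive_of_projective
  have h1 : IsTotallyReflexive R C p.P₁ := hC.isTotallyReflexive_of_projective
  set δ := cDualMap C p.d
  set B := LinearMap.range δ
  have hι : Function.Injective B.subtype := B.injective_subtype
  have hιq : Function.Exact B.subtype B.mkQ := LinearMap.exact_subtype_mkQ B
  have hq : Function.Surjective B.mkQ := B.mkQ_surjective
  have hε : Function.Injective (cDualMap C p.ε) := injective_cDualMap p.surjective
  have hεδ : Function.Exact (cDualMap C p.ε) δ.rangeRestrict := by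
    intro x
    rw [← exact_cDualMap p.exact p.surjective x]
    exact Subtype.ext_iff
  have hδ : Function.Surjective δ.rangeRestrict := δ.surjective_rangeRestrict
  have eT : ∀ i, 1 ≤ i → (ExtVanishes R (p.cTranspose C) C (i + 1) ↔ ExtVanishes R B C i) :=
    fun i hi ↦ ⟨fun h ↦ extVanishes_sub_left hι hιq hq (h1.ext_dual_vanishes _ hi) h,
      fun h ↦ extVanishes_quot_left hι hιq hq h (h1.ext_dual_vanishes _ (Nat.succ_pos _))⟩
  have eB : ∀ i, 1 ≤ i → (ExtVanishes R B C (i + 1) ↔ ExtVanishes R (M →ₗ[R] C) C i) :=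
    fun i hi ↦ ⟨fun h ↦ extVanishes_sub_left hε hεδ hδ (h0.ext_dual_vanishes _ hi) h,
      fun h ↦ extVanishes_quot_left hε hεδ hδ h (h0.ext_dual_vanishes _ (Nat.succ_pos _))⟩
  have e2 : ExtVanishes R B C 1 ↔ Function.Surjective (biduality R C M) := by
    have hcomp : ⇑(cDualMap C (cDualMap C p.ε)) ∘ biduality R C p.P₀ =
      biduality R C M ∘ p.ε := rfl
    rw [← p.surjective.of_comp_iff, ← hcomp]
    refine ⟨fun h ↦ (surjective_cDualMap_of_extVanishes hε hεδ hδ h).comp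
      h0.biduality_bijective.2, fun h ↦ extVanishes_one_of_surjective_cDualMap hε hεδ hδ h.of_comp
      (h0.ext_dual_vanishes 1 one_pos)⟩
  -- Vanishing of Ext¹ says that every functional on B extends to P₁†. A functional on B pulls back
  -- to an element of P₀†† = P₀ whose image in M lies in the kernel of λ_M; it extends exactly when
  -- that element comes from P₁.
  have e1 : ExtVanishes R (p.cTranspose C) C 1 ↔ Function.Injective (biduality R C M) := by
    have hfac : B.subtype ∘ₗ δ.rangeRestrict = δ := rfl
    constructor
    · intro h
      rw [injective_iff_map_eq_zero]
      intro m hm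
      obtain ⟨a, rfl⟩ := p.surjective m
      rw [← cDualMap_cDualMap_biduality] at hm
      obtain ⟨ψ, hψ⟩ := (exact_cDualMap hεδ hδ _).1 hm
      obtain ⟨Φ, rfl⟩ := surjective_cDualMap_of_extVanishes hι hιq hq h ψ
      obtain ⟨b, rfl⟩ := h1.biduality_bijective.2 Φ
      have : biduality R C p.P₀ (p.d b) = biduality R C p.P₀ a := hψ
      rw [← h0.biduality_bijective.1 this, p.exact.apply_apply_eq_zero]
    · intro h
      refine extVanishes_one_of_surjective_cDualMap hι hιq hq (fun ψ ↦ ?_)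
        (h1.ext_dual_vanishes 1 one_pos)
      obtain ⟨a, ha⟩ := h0.biduality_bijective.2 (cDualMap C δ.rangeRestrict ψ)
      have hz : biduality R C M (p.ε a) = 0 := by
        rw [← cDualMap_cDualMap_biduality, ha]
        exact (exact_cDualMap hεδ hδ).apply_apply_eq_zero ψ
      obtain ⟨b, rfl⟩ := (p.exact a).1 (h (hz.trans (map_zero _).symm))
      exact ⟨biduality R C p.P₁ b, injective_cDualMap hδ ha⟩
  constructor
  · rintro h i hi hn
    match i, hi with
    | 1, _ => exact e1.2 (h.1 hn)
    | 2, _ => exact (eT 1 le_rfl).2 (e2.2 (h.2 hn))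
    | i + 3, _ =>
      exact (eT (i + 2) (by lia)).2 ((eB (i + 1) (by lia)).2 (h.3 (i + 1) (by lia) hn))
  · intro h
    exact ⟨fun hn ↦ e1.1 (h 1 le_rfl hn), fun hn ↦ e2.1 ((eT 1 le_rfl).1 (h 2 (by lia) hn)),
      fun i hi hn ↦ (eB i hi).1 ((eT (i + 1) (by lia)).1 (h (i + 2) (by lia) hn))⟩

lemma nonempty_projectivePresentation [IsNoetherianRing R] [Module.Finite R M] :
    Nonempty (ProjectivePresentation R M) := by
  obtain ⟨m, ε, hε⟩ := Module.Finite.exists_fin' R M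
  obtain ⟨k, d, hd⟩ := Module.Finite.exists_fin' R (LinearMap.ker ε)
  refine ⟨{ P₀ := Fin m → R, P₁ := Fin k → R, finite₀ := inferInstance, finite₁ := inferInstance,
            projective₀ := inferInstance, projective₁ := inferInstance,
            d := (LinearMap.ker ε).subtype ∘ₗ d, ε := ε, exact := ?_, surjective := hε }⟩
  rw [LinearMap.exact_iff, LinearMap.range_comp, LinearMap.range_eq_top.2 hd]
  simp

lemma isTorsionfree_iff_isBidualTorsionfree [IsNoetherianRing R] [Module.Finite R M]
    (hC : IsSemidualizing R C) (n : ℕ) :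
    IsTorsionfree R C M n ↔ IsBidualTorsionfree R C M n := by
  obtain ⟨p⟩ := nonempty_projectivePresentation (R := R) (M := M)
  exact ⟨fun h ↦ (isBidualTorsionfree_iff_extVanishes_cTranspose hC p n).2 (h p),
    fun h q ↦ (isBidualTorsionfree_iff_extVanishes_cTranspose hC q n).1 h⟩

end Transpose

/-! ### Universal pushforwards and syzygies -/

section Copresentation

variable {R : Type u} [CommRing R] {C : Type u} [AddCommGroup C] [Module R C]
  {M : Type u} [AddCommGroup M] [Module R M]

/-- The coordinates of f are finitely many generators of M†, so every functional on M is a linear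
combination of coordinate projections composed with f. -/
lemma exists_surjective_cDualMap [IsNoetherianRing R] [Module.Finite R M] [Module.Finite R C] :
    ∃ (m : ℕ) (f : M →ₗ[R] (Fin m → C)), Function.Surjective (cDualMap C f) := by
  obtain ⟨m, φ, hφ⟩ := Module.Finite.exists_fin (R := R) (M := M →ₗ[R] C)
  refine ⟨m, LinearMap.pi φ, fun ψ ↦ ?_⟩
  obtain ⟨a, rfl⟩ := (Submodule.mem_span_range_iff_exists_fun R).1
    (show ψ ∈ Submodule.span R (Set.range φ) from hφ ▸ trivial)
  refine ⟨∑ j, a j • LinearMap.proj j, ?_⟩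
  ext x
  simp [cDualMap_apply]

variable (R C M) in
/-- The trivial copresentation of length zero. -/
def CopresentationBy.nil : CopresentationBy R C M 0 where
  P _ := M
  ι := LinearMap.id
  d _ := 0
  isAddSummand _ h := absurd h (Nat.not_lt_zero _)
  injective := Function.injective_id
  exact_zero h := absurd h (by lia)
  exact_succ _ h := absurd h (by lia)

/-- The filler term in degree 0 is `M` with the identity map, so surjectivity of the dual holds even
at length zero and the induction can start there. -/
lemma CopresentationBy.dualExact_nil : (CopresentationBy.nil R C M).DualExact where
  surjective φ := ⟨φ, rfl⟩
  exact_zero h := absurd h (by lia)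
  exact_succ _ h := absurd h (by lia)

section Cons

variable {Y Z : Type u} [AddCommGroup Y] [Module R Y] [AddCommGroup Z] [Module R Z]
  {f : M →ₗ[R] Y} {g : Y →ₗ[R] Z} {n : ℕ}

/-- Splicing a short exact sequence `0 → M → Y → Z → 0` with a copresentation of `Z`. -/
def CopresentationBy.cons (σ : CopresentationBy R C Z n) (hY : IsAddSummand R C Y)
    (hf : Function.Injective f) (hfg : Function.Exact f g) (hg : Function.Surjective g) :
    CopresentationBy R C M (n + 1) where
  P
    | 0 => Y
    | i + 1 => σ.P i
  addCommGroup
    | 0 => inferInstanceAs (AddCommGroup Y)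
    | i + 1 => inferInstanceAs (AddCommGroup (σ.P i))
  module
    | 0 => inferInstanceAs (Module R Y)
    | i + 1 => inferInstanceAs (Module R (σ.P i))
  ι := f
  d
    | 0 => σ.ι ∘ₗ g
    | i + 1 => σ.d i
  isAddSummand
    | 0, _ => hY
    | i + 1, h => σ.isAddSummand i (by lia)
  injective := hf
  exact_zero _ := hfg.comp_injective σ.ι σ.injective (map_zero σ.ι)
  exact_succ
    | 0, h => (LinearMap.exact_iff.2 (by
        rw [LinearMap.exact_iff.1 (σ.exact_zero (by lia)), LinearMap.range_comp,
          LinearMap.range_eq_top.2 hg, Submodule.map_top]))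
    | i + 1, h => σ.exact_succ i (by lia)

lemma CopresentationBy.DualExact.cons {σ : CopresentationBy R C Z n} (h : σ.DualExact)
    (hY : IsAddSummand R C Y) (hf : Function.Injective f) (hfg : Function.Exact f g)
    (hg : Function.Surjective g) (hfd : Function.Surjective (cDualMap C f)) :
    (σ.cons hY hf hfg hg).DualExact where
  surjective := hfd
  exact_zero _ := by
    change Function.Exact (cDualMap C g ∘ₗ cDualMap C σ.ι) (cDualMap C f)
    rw [LinearMap.exact_iff, LinearMap.range_comp, LinearMap.range_eq_top.2 h.surjective,
      Submodule.map_top]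
    exact LinearMap.exact_iff.1 (exact_cDualMap hfg hg)
  exact_succ
    | 0, hn => (h.exact_zero (by lia)).comp_injective _ (injective_cDualMap hg) (map_zero _)
    | i + 1, hn => h.exact_succ i (by lia)

end Cons

lemma IsBidualTorsionfree.hasUniversalPushforward [IsNoetherianRing R]
    (hC : IsSemidualizing R C) {n : ℕ} [Module.Finite R M] (h : IsBidualTorsionfree R C M n) :
    HasUniversalPushforward R C M n := by
  induction n generalizing M with
  | zero => exact ⟨_, CopresentationBy.dualExact_nil⟩
  | succ n ih =>
    have := hC.finite
    obtain ⟨m, f, hfd⟩ := exists_surjective_cDualMap (R := R) (C := C) (M := M)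
    have hY := hC.isTotallyReflexive_of_isAddSummand (isAddSummand_pi (R := R) (X := C) m)
    have hf := (injective_biduality_iff_of_surjective_cDualMap hfd hY.biduality_bijective.1).1
      (h.injective (by lia))
    have hfg := LinearMap.exact_map_mkQ_range f
    have hg := (LinearMap.range f).mkQ_surjective
    obtain ⟨σ, hσ⟩ := ih ((isBidualTorsionfree_succ_iff hY hfd hf hfg hg n).1 h)
    exact ⟨_, hσ.cons (isAddSummand_pi m) hf hfg hg hfd⟩

lemma IsSyzygy.exists_isSyzygy_quotient {n : ℕ} (h : IsSyzygy R C M (n + 1)) :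
    ∃ (Y : Type u) (_ : AddCommGroup Y) (_ : Module R Y) (f : M →ₗ[R] Y),
      IsAddSummand R C Y ∧ Function.Injective f ∧
        IsSyzygy R C (Y ⧸ LinearMap.range f) n := by
  obtain ⟨σ⟩ := h
  refine ⟨σ.P 0, inferInstance, inferInstance, σ.ι, σ.isAddSummand 0 (Nat.succ_pos n),
    σ.injective, ?_⟩
  -- At length one the next map need not be exact after `ι`, but then being a 0-syzygy asks nothing
  -- of the cokernel.
  rcases n with _ | n
  · exact ⟨CopresentationBy.nil R C _⟩
  have hex := LinearMap.exact_iff.1 (σ.exact_zero (by lia))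
  refine ⟨{ P := fun i ↦ σ.P (i + 1), ι := (LinearMap.range σ.ι).liftQ (σ.d 0) hex.ge,
            d := fun i ↦ σ.d (i + 1), isAddSummand := fun i hi ↦ σ.isAddSummand _ (by lia),
            injective := ?_, exact_zero := fun hn ↦ ?_,
            exact_succ := fun i hi ↦ σ.exact_succ (i + 1) (by lia) }⟩
  · exact LinearMap.ker_eq_bot.1 (Submodule.ker_liftQ_eq_bot _ _ _ hex.le)
  · rw [LinearMap.exact_iff, Submodule.range_liftQ]
    exact LinearMap.exact_iff.1 (σ.exact_succ 0 (by lia))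

end Copresentation

/-! ### Localization of semidualizing modules and of Ext vanishing -/

section Localization

variable {R : Type u} [CommRing R] (S : Submonoid R) {C M N L : Type u} [AddCommGroup C]
  [Module R C] [AddCommGroup M] [Module R M] [AddCommGroup N] [Module R N]
  [AddCommGroup L] [Module R L]

lemma localizedModule_map_exact {f : M →ₗ[R] N} {g : N →ₗ[R] L} (h : Function.Exact f g) :
    Function.Exact (LocalizedModule.map S f) (LocalizedModule.map S g) :=
  IsLocalizedModule.map_exact S (LocalizedModule.mkLinearMap S M)
    (LocalizedModule.mkLinearMap S N) (LocalizedModule.mkLinearMap S L) f g h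

lemma localizedModule_map_injective {f : M →ₗ[R] N} (h : Function.Injective f) :
    Function.Injective (LocalizedModule.map S f) :=
  IsLocalizedModule.map_injective S (LocalizedModule.mkLinearMap S M)
    (LocalizedModule.mkLinearMap S N) f h

lemma localizedModule_map_comp (f : M →ₗ[R] N) (g : N →ₗ[R] L) :
    LocalizedModule.map S (g ∘ₗ f) = LocalizedModule.map S g ∘ₗ LocalizedModule.map S f := by
  ext x
  induction x using LocalizedModule.induction_on with
  | h m s => simp [LocalizedModule.map_mk]

lemma smul_mk_one (s : S) (x : LocalizedModule S M) :
    (Localization.mk 1 s : Localization S) • (s : R) • x = x := by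
  rw [← algebraMap_smul (Localization S) (s : R) x, ← mul_smul, ← Localization.mk_one_eq_algebraMap,
    Localization.mk_mul, one_mul, mul_one, Localization.mk_self, one_smul]

/-- Hom out of a finitely presented module commutes with localization, so a map of localizations is
a localized map up to a denominator. -/
lemma exists_map_eq_smul [Module.FinitePresentation R M]
    (φ : LocalizedModule S M →ₗ[Localization S] LocalizedModule S N) :
    ∃ (h : M →ₗ[R] N) (s : S), φ = (Localization.mk 1 s : Localization S) •
      LocalizedModule.map S h := by
  obtain ⟨⟨h, s⟩, hs⟩ := IsLocalizedModule.surj S (LocalizedModule.map S (M := M) (N := N)) φ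
  refine ⟨h, s, ?_⟩
  rw [← hs]
  ext x
  exact (smul_mk_one S s (φ x)).symm

lemma surjective_cDualMap_localizedModule [Module.FinitePresentation R M] {f : M →ₗ[R] N}
    (hf : Function.Surjective (cDualMap C f)) :
    Function.Surjective (cDualMap (LocalizedModule S C) (LocalizedModule.map S f)) := by
  intro φ
  obtain ⟨h, s, rfl⟩ := exists_map_eq_smul S φ
  obtain ⟨h', rfl⟩ := hf h
  refine ⟨(Localization.mk 1 s : Localization S) • LocalizedModule.map S h', ?_⟩
  rw [cDualMap_apply, cDualMap_apply, localizedModule_map_comp, LinearMap.smul_comp]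

lemma IsAddSummand.localizedModule (h : IsAddSummand R C M) :
    IsAddSummand (Localization S) (LocalizedModule S C) (LocalizedModule S M) := by
  obtain ⟨m, s, r, hrs⟩ := h
  refine ⟨m, LinearMap.pi fun j ↦ LocalizedModule.map S (LinearMap.proj j ∘ₗ s),
    LinearMap.lsum _ _ (Localization S) fun j ↦
      LocalizedModule.map S (r ∘ₗ LinearMap.single R (fun _ ↦ C) j), ?_⟩
  -- The localization of `Fin m → C` is not literally a power of the localization of C. Writing r ∘
  -- s = id as a sum over coordinates gives an identity that localizes term by term.
  have hsum : ∑ j, (r ∘ₗ LinearMap.single R (fun _ ↦ C) j) ∘ₗ LinearMap.proj j ∘ₗ s =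
      LinearMap.id := by
    ext x
    have := DFunLike.congr_fun (LinearMap.lsum_single (R := R) (φ := fun _ : Fin m ↦ C) R) (s x)
    simp only [LinearMap.lsum_apply, LinearMap.sum_apply, LinearMap.comp_apply,
      LinearMap.id_apply] at this ⊢
    rw [← map_sum, this]
    exact DFunLike.congr_fun hrs x
  have h2 := congrArg (LocalizedModule.map S) hsum
  rw [map_sum, LocalizedModule.map_id] at h2
  rw [← h2]
  ext x
  simp [LinearMap.lsum_apply, localizedModule_map_comp]

/-- For a free cover with kernel K, vanishing of Ext¹ means that maps K → N extend to the free
module, which survives localization; higher degrees follow by replacing M with K. -/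
lemma extVanishes_localizedModule [IsNoetherianRing R] [Module.Finite R M] {i : ℕ} (hi : 0 < i)
    (h : ExtVanishes R M N i) :
    ExtVanishes (Localization S) (LocalizedModule S M) (LocalizedModule S N) i := by
  obtain ⟨i, rfl⟩ := Nat.exists_eq_succ_of_ne_zero hi.ne'
  induction i generalizing M with
  | zero =>
    obtain ⟨m, g, hg⟩ := Module.Finite.exists_fin' R M
    have hinj := (LinearMap.ker g).injective_subtype
    have hex := LinearMap.exact_subtype_ker_map g
    have := Module.finitePresentation_of_finite R (LinearMap.ker g)
    exact extVanishes_one_of_surjective_cDualMap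
      (localizedModule_map_injective S hinj) (localizedModule_map_exact S hex)
      (LocalizedModule.map_surjective S g hg)
      (surjective_cDualMap_localizedModule S (surjective_cDualMap_of_extVanishes hinj hex hg h))
      (extVanishes_of_projective one_pos)
  | succ i ih =>
    obtain ⟨m, g, hg⟩ := Module.Finite.exists_fin' R M
    have hinj := (LinearMap.ker g).injective_subtype
    have hex := LinearMap.exact_subtype_ker_map g
    exact extVanishes_quot_left
      (localizedModule_map_injective S hinj) (localizedModule_map_exact S hex)
      (LocalizedModule.map_surjective S g hg)
      (ih (Nat.succ_pos _)
        (extVanishes_sub_left hinj hex hg (extVanishes_of_projective (Nat.succ_pos _)) h))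
      (extVanishes_of_projective (Nat.succ_pos _))

lemma IsSemidualizing.localizedModule [IsNoetherianRing R] (hC : IsSemidualizing R C) :
    IsSemidualizing (Localization S) (LocalizedModule S C) := by
  have := hC.finite
  have := Module.finitePresentation_of_finite R C
  refine ⟨inferInstance, ⟨?_, fun φ ↦ ?_⟩,
    fun i hi ↦ extVanishes_localizedModule S hi (hC.ext_vanishes i hi)⟩
  · rw [injective_iff_map_eq_zero]
    intro a ha
    induction a using Localization.induction_on with
    | H y =>
      obtain ⟨r, s⟩ := y
      -- If r/s kills the localization of C, finite generation gives one `t` in `S` with t r C = 0,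
      -- whence t r = 0 as R acts faithfully on C.
      have h0 : LocalizedModule.mkLinearMap S C ∘ₗ (r • LinearMap.id) =
          LocalizedModule.mkLinearMap S C ∘ₗ 0 := by
        ext c
        have := DFunLike.congr_fun ha (LocalizedModule.mk c 1)
        have h2 := congrArg (fun x ↦ (s : R) • x) this
        simp only [LinearMap.lsmul_apply, LocalizedModule.mk_smul_mk, LinearMap.zero_apply,
          smul_zero, LocalizedModule.smul'_mk, mul_one] at h2
        rw [← Submonoid.smul_def, LocalizedModule.mk_cancel] at h2
        simpa [LocalizedModule.smul'_mk] using h2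
      obtain ⟨t, ht⟩ := Module.Finite.exists_smul_of_comp_eq_of_isLocalizedModule S
        (LocalizedModule.mkLinearMap S C) _ _ h0
      have htr : (t : R) * r = 0 := by
        refine hC.homothety_bijective.1 ?_
        ext c
        have := DFunLike.congr_fun ht c
        simpa [mul_smul, Submonoid.smul_def] using this
      rw [← Localization.mk_zero 1, Localization.mk_eq_mk_iff, Localization.r_iff_exists]
      exact ⟨t, by simpa using htr⟩
  · obtain ⟨h, s, rfl⟩ := exists_map_eq_smul S φ
    obtain ⟨r, rfl⟩ := hC.homothety_bijective.2 h
    refine ⟨Localization.mk r s, ?_⟩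
    ext x
    induction x using LocalizedModule.induction_on with
    | h m t =>
      simp [LocalizedModule.map_mk, LocalizedModule.mk_smul_mk]

/-- Localizing the ring as a module over itself gives the localized ring. -/
noncomputable def localizedModuleSelfEquiv : LocalizedModule S R ≃ₗ[Localization S] Localization S :=
  (IsLocalizedModule.iso S (Algebra.linearMap R (Localization S))).extendScalarsOfIsLocalization S
    (Localization S)

end Localization

open Abelian in
lemma surjective_comp_of_extVanishes {A : Type u} [CommRing A] {C X Y Z : Type u} [AddCommGroup C]
    [Module A C] [AddCommGroup X] [Module A X] [AddCommGroup Y] [Module A Y] [AddCommGroup Z]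
    [Module A Z] {f : X →ₗ[A] Y} {g : Y →ₗ[A] Z} (hf : Function.Injective f)
    (hfg : Function.Exact f g) (hg : Function.Surjective g) (h : ExtVanishes A C X 1) :
    Function.Surjective (fun φ : C →ₗ[A] Y ↦ g ∘ₗ φ) := by
  intro φ
  obtain ⟨a, ha⟩ := Ext.covariant_sequence_exact₃ (ModuleCat.of A C)
    (shortExact_shortComplexOfExact hf hfg hg)
    (Ext.mk₀ (ModuleCat.ofHom φ)) (zero_add 1) (extVanishes_iff.1 h _)
  obtain ⟨b, rfl⟩ := Ext.addEquiv₀.symm.surjective a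
  refine ⟨b.hom, ?_⟩
  simp only [Ext.addEquiv₀_symm_apply, Ext.mk₀_comp_mk₀] at ha
  exact congrArg ModuleCat.Hom.hom (Ext.addEquiv₀.symm.injective ha)

/-! ### Depth through Ext from the residue field -/

section Depth

open scoped Pointwise

variable {A : Type u} [CommRing A] [IsLocalRing A]
  {C N X Y Z : Type u} [AddCommGroup C] [Module A C] [AddCommGroup N] [Module A N]
  [AddCommGroup X] [Module A X] [AddCommGroup Y] [Module A Y] [AddCommGroup Z] [Module A Z]

/-- `Ext^i(k, N) = 0` for `i < e`, where `k` is the residue field. -/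
def ExtDepthGE (A : Type u) [CommRing A] [IsLocalRing A] (N : Type u) [AddCommGroup N]
    [Module A N] (e : ℕ) : Prop :=
  ∀ i < e, ExtVanishes A (A ⧸ IsLocalRing.maximalIdeal A) N i

lemma ExtDepthGE.mono {d e : ℕ} (h : ExtDepthGE A N e) (hde : d ≤ e) : ExtDepthGE A N d :=
  fun i hi ↦ h i (hi.trans_le hde)

lemma ExtDepthGE.of_isAddSummand {e : ℕ} (h : ExtDepthGE A Y e) (hX : IsAddSummand A Y X) :
    ExtDepthGE A X e :=
  fun i hi ↦ hX.extVanishes_right (h i hi)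

lemma ExtDepthGE.congr {e : ℕ} (h : ExtDepthGE A Y e) (φ : X ≃ₗ[A] Y) : ExtDepthGE A X e :=
  fun i hi ↦ (h i hi).retract_right φ.toLinearMap φ.symm.toLinearMap (by ext; simp)

lemma ExtDepthGE.sub {f : X →ₗ[A] Y} {g : Y →ₗ[A] Z} (hf : Function.Injective f)
    (hfg : Function.Exact f g) (hg : Function.Surjective g) {e : ℕ}
    (hY : ExtDepthGE A Y (e + 1)) (hZ : ExtDepthGE A Z e) : ExtDepthGE A X (e + 1) := by
  rintro (_ | i) hi
  · have := extVanishes_zero_iff.1 (hY 0 hi)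
    refine extVanishes_zero_iff.2 ⟨fun a b ↦ ?_⟩
    refine LinearMap.ext fun x ↦ ?_
    exact hf (DFunLike.congr_fun (Subsingleton.elim (f ∘ₗ a) (f ∘ₗ b)) _)
  · exact extVanishes_sub_right hf hfg hg (hZ i (by lia)) (hY _ hi)

lemma ExtDepthGE.quotient {f : X →ₗ[A] Y} {g : Y →ₗ[A] Z} (hf : Function.Injective f)
    (hfg : Function.Exact f g) (hg : Function.Surjective g) {e : ℕ}
    (hY : ExtDepthGE A Y e) (hX : ExtDepthGE A X (e + 1)) : ExtDepthGE A Z e :=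
  fun i hi ↦ extVanishes_quot_right hf hfg hg (hY i hi) (hX (i + 1) (by lia))

/-- An element killed by the maximal ideal is the image of 1 under a map from the residue field, and
positive depth leaves only the zero map. -/
lemma ExtDepthGE.eq_zero_of_smul_eq_zero {e : ℕ} (h : ExtDepthGE A N e) (he : 1 ≤ e) {y : N}
    (hy : ∀ a ∈ IsLocalRing.maximalIdeal A, a • y = 0) : y = 0 := by
  have := extVanishes_zero_iff.1 (h 0 he)
  have h0 : (IsLocalRing.maximalIdeal A).liftQ (LinearMap.toSpanSingleton A N y)
      (fun a ha ↦ hy a ha) = 0 := Subsingleton.elim _ _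
  rw [← one_smul A y]
  exact DFunLike.congr_fun h0 (Submodule.Quotient.mk 1)

lemma length_le_depth {rs : List A} (hrs : ∀ r ∈ rs, r ∈ IsLocalRing.maximalIdeal A)
    (h : RingTheory.Sequence.IsRegular N rs) : (rs.length : ℕ∞) ≤ depth A N := by
  rw [depth]
  split_ifs
  · exact le_top
  · exact le_iSup (fun rs : {rs : List A // (∀ r ∈ rs, r ∈ IsLocalRing.maximalIdeal A) ∧
      RingTheory.Sequence.IsRegular N rs} ↦ (rs.1.length : ℕ∞)) ⟨rs, hrs, h⟩

lemma exists_isRegular_of_le_depth [Nontrivial N] {e : ℕ} (h : (e : ℕ∞) ≤ depth A N) :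
    ∃ rs : List A, (∀ r ∈ rs, r ∈ IsLocalRing.maximalIdeal A) ∧
      RingTheory.Sequence.IsRegular N rs ∧ e ≤ rs.length := by
  rcases e with _ | e
  · exact ⟨[], by simp, .nil _ _, le_rfl⟩
  rw [depth, if_neg (not_subsingleton N)] at h
  obtain ⟨⟨rs, h1, h2⟩, hlt⟩ := lt_iSup_iff.1
    ((ENat.natCast_lt_natCast.2 (Nat.lt_succ_self e)).trans_le h)
  exact ⟨rs, h1, h2, Nat.succ_le_of_lt (ENat.natCast_lt_natCast.1 hlt)⟩

lemma maximalIdeal_smul_top_lt_top [Nontrivial N] [Module.Finite A N] :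
    IsLocalRing.maximalIdeal A • (⊤ : Submodule A N) < ⊤ := by
  refine lt_top_iff_ne_top.2 fun h ↦ ?_
  have := Submodule.eq_bot_of_le_smul_of_le_jacobson_bot (IsLocalRing.maximalIdeal A) _
    (Module.finite_def.1 ‹Module.Finite A N›) h.ge (IsLocalRing.maximalIdeal_le_jacobson _)
  exact bot_ne_top this.symm

lemma support_residueField : Module.support A (A ⧸ IsLocalRing.maximalIdeal A) =
    PrimeSpectrum.zeroLocus (IsLocalRing.maximalIdeal A : Set A) := by
  rw [Module.support_eq_zeroLocus, Ideal.annihilator_quotient]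

variable [IsNoetherianRing A]

/-- Rees's theorem; for the zero module both sides hold trivially. -/
lemma natCast_le_depth_iff [Module.Finite A N] {e : ℕ} :
    (e : ℕ∞) ≤ depth A N ↔ ExtDepthGE A N e := by
  rcases subsingleton_or_nontrivial N with hN | hN
  · simp only [depth, if_pos hN, le_top, true_iff]
    exact fun i _ ↦ extVanishes_of_subsingleton_right i
  constructor
  · intro h i hi
    obtain ⟨rs, h1, h2, h3⟩ := exists_isRegular_of_le_depth h
    exact ModuleCat.subsingleton_ext_of_exists_isRegular (IsLocalRing.maximalIdeal A)
      (ModuleCat.of A (A ⧸ IsLocalRing.maximalIdeal A)) support_residueField.subset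
      (ModuleCat.of A N) maximalIdeal_smul_top_lt_top rs h1 h2 i (hi.trans_le h3)
  · intro h
    obtain ⟨rs, rfl, h1, h2⟩ := ModuleCat.exists_isRegular_of_exists_subsingleton_ext
      (IsLocalRing.maximalIdeal A) e (ModuleCat.of A N) maximalIdeal_smul_top_lt_top
      (ModuleCat.of A (A ⧸ IsLocalRing.maximalIdeal A)) support_residueField h
    exact length_le_depth h1 h2

lemma exact_lsmul_mkQ {A : Type u} [CommRing A] {N : Type u} [AddCommGroup N] [Module A N]
    (r : A) : Function.Exact (LinearMap.lsmul A N r)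
    (Submodule.mkQ (r • (⊤ : Submodule A N))) :=
  LinearMap.exact_lsmul_mkQ_smul_top N r

/-- Regular elements descend from Hom(C, N) to N because C is faithful, and the vanishing of Ext
gives Hom(C, N)/r ≅ Hom(C, N/rN) and persists for N/rN, so the induction continues. -/
lemma isWeaklyRegular_of_isWeaklyRegular_linearMap {A : Type u} [CommRing A] [IsNoetherianRing A]
    {C N : Type u} [AddCommGroup C] [Module A C] [AddCommGroup N] [Module A N]
    [Module.Finite A C] [Module.Finite A N]
    (hC : Module.annihilator A C = ⊥) (hN : ∀ i, 0 < i → ExtVanishes A C N i) {rs : List A}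
    (h : RingTheory.Sequence.IsWeaklyRegular (C →ₗ[A] N) rs) :
    RingTheory.Sequence.IsWeaklyRegular N rs := by
  induction rs generalizing N with
  | nil => exact .nil _ _
  | cons r rs ih =>
    rw [RingTheory.Sequence.isWeaklyRegular_cons_iff] at h ⊢
    obtain ⟨hr, hrs⟩ := h
    have hrN : IsSMulRegular N r := by
      rw [isSMulRegular_iff_ker_lsmul_eq_bot]
      set T := LinearMap.ker (LinearMap.lsmul A N r)
      have : Subsingleton (C →ₗ[A] T) := by
        refine ⟨fun a b ↦ ?_⟩
        have h0 : ∀ φ : C →ₗ[A] T, T.subtype ∘ₗ φ = 0 := fun φ ↦ by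
          refine hr ?_
          ext c
          exact (LinearMap.mem_ker.1 (φ c).2).trans (smul_zero r).symm
        ext c
        have := (h0 a).trans (h0 b).symm
        exact DFunLike.congr_fun this c
      -- Hom(C, T) = 0 yields a T-regular element of the annihilator of C. That annihilator is zero,
      -- and 0 is regular only on the zero module.
      obtain ⟨x, hx, hreg⟩ := IsSMulRegular.subsingleton_linearMap_iff.1 this
      rw [hC, Submodule.mem_bot] at hx
      subst hx
      have := IsSMulRegular.zero_iff_subsingleton.1 hreg
      exact Submodule.eq_bot_of_subsingleton
    refine ⟨hrN, ih (fun i hi ↦ extVanishes_quot_right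
      (f := LinearMap.lsmul A N r) hrN (exact_lsmul_mkQ r)
      (Submodule.mkQ_surjective _) (hN i hi) (hN _ (Nat.succ_pos i))) ?_⟩
    let π : (C →ₗ[A] N) →ₗ[A] (C →ₗ[A] QuotSMulTop r N) :=
      LinearMap.llcomp A C N _ (Submodule.mkQ _)
    have hπ : Function.Surjective π := surjective_comp_of_extVanishes
      (f := LinearMap.lsmul A N r) hrN (exact_lsmul_mkQ r) (Submodule.mkQ_surjective _)
      (hN 1 one_pos)
    have hker : LinearMap.ker π = r • (⊤ : Submodule A (C →ₗ[A] N)) := by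
      ext φ
      rw [Submodule.mem_smul_pointwise_iff_exists]
      constructor
      · intro hφ
        have hmem : ∀ c, ∃ n, r • n = φ c := fun c ↦ by
          have : (Submodule.mkQ (r • (⊤ : Submodule A N))) (φ c) = 0 :=
            DFunLike.congr_fun (LinearMap.mem_ker.1 hφ) c
          exact (exact_lsmul_mkQ r _).1 this
        choose ψ hψ using hmem
        -- Division by `r` value by value is linear because `r` is regular on N.
        refine ⟨{ toFun := ψ, map_add' := fun a b ↦ hrN ?_, map_smul' := fun a b ↦ hrN ?_ },
          trivial, ?_⟩
        · simp only [smul_add, hψ, map_add]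
        · simp only [RingHom.id_apply, hψ, map_smul, smul_comm r a]
        · ext c
          exact hψ c
      · rintro ⟨ψ, -, rfl⟩
        rw [LinearMap.mem_ker]
        ext c
        exact (exact_lsmul_mkQ r).apply_apply_eq_zero (ψ c)
    exact (((Submodule.quotEquivOfEq _ _ hker.symm).trans
      (π.quotKerEquivOfSurjective hπ)).isWeaklyRegular_congr rs).1 hrs

lemma IsSemidualizing.extDepthGE (hC : IsSemidualizing A C) {e : ℕ}
    (h : (e : ℕ∞) ≤ depth A A) : ExtDepthGE A C e := by
  have := hC.finite
  rcases subsingleton_or_nontrivial C with hsub | hnt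
  · exact fun i _ ↦ extVanishes_of_subsingleton_right i
  obtain ⟨rs, h1, h2, h3⟩ := exists_isRegular_of_le_depth h
  have hann : Module.annihilator A C = ⊥ := by
    refine (Submodule.eq_bot_iff _).2 fun a ha ↦ hC.homothety_bijective.1 ?_
    ext c
    simpa using Module.mem_annihilator.1 ha c
  have hw := isWeaklyRegular_of_isWeaklyRegular_linearMap hann hC.ext_vanishes
    ((hC.homothetyEquiv.isWeaklyRegular_congr rs).1 h2.1)
  refine (natCast_le_depth_iff.1 (length_le_depth h1 ?_)).mono h3
  exact (IsLocalRing.isRegular_iff_isWeaklyRegular_of_subset_maximalIdeal h1).2 hw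

end Depth

/-! ### Serre's conditions -/

section Serre

variable {R : Type u} [CommRing R] {C M : Type u} [AddCommGroup C] [Module R C] [AddCommGroup M]
  [Module R M]

lemma IsSyzygy.extDepthGE {n e : ℕ} (h : IsSyzygy R C M n) (he : e ≤ n) (p : Ideal R) [p.IsPrime]
    (hC : ExtDepthGE (Localization.AtPrime p) (LocalizedModule p.primeCompl C) e) :
    ExtDepthGE (Localization.AtPrime p) (LocalizedModule p.primeCompl M) e := by
  induction n generalizing M e with
  | zero => exact fun i hi ↦ absurd hi (by lia)
  | succ n ih =>
    rcases e with _ | e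
    · exact fun i hi ↦ absurd hi (Nat.not_lt_zero i)
    obtain ⟨Y, _, _, f, hY, hf, hZ⟩ := h.exists_isSyzygy_quotient
    exact ExtDepthGE.sub (localizedModule_map_injective p.primeCompl hf)
      (localizedModule_map_exact p.primeCompl (LinearMap.exact_map_mkQ_range f))
      (LocalizedModule.map_surjective p.primeCompl _ (Submodule.mkQ_surjective _))
      (hC.of_isAddSummand (hY.localizedModule p.primeCompl))
      (ih hZ (by lia) (hC.mono (Nat.le_succ e)))

variable [IsNoetherianRing R]

lemma IsSyzygy.satisfiesSTilde [Module.Finite R M] (hC : IsSemidualizing R C) {n : ℕ}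
    (h : IsSyzygy R C M n) : SatisfiesSTilde R M n := by
  intro p _
  -- Depths may be infinite, while the Ext criterion tests finite bounds.
  refine ENat.forall_natCast_le_iff_le.1 fun e he ↦ ?_
  rw [le_min_iff] at he
  exact natCast_le_depth_iff.2 (h.extDepthGE (ENat.natCast_le_natCast.1 he.1) p
    ((hC.localizedModule p.primeCompl).extDepthGE he.2))

/-- Condition (S_n) on R speaks of R localized as a module, while (S̃_n) speaks of the localized
ring; the two are isomorphic. -/
lemma depth_localizedModule_self_le (p : Ideal R) [p.IsPrime] :
    depth (Localization.AtPrime p) (LocalizedModule p.primeCompl R) ≤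
      depth (Localization.AtPrime p) (Localization.AtPrime p) := by
  refine ENat.forall_natCast_le_iff_le.1 fun e he ↦ ?_
  exact natCast_le_depth_iff.2
    ((natCast_le_depth_iff.1 he).congr (localizedModuleSelfEquiv p.primeCompl).symm)

lemma SatisfiesSTilde.satisfiesS {n : ℕ} (hR : SatisfiesS R R n) (h : SatisfiesSTilde R M n) :
    SatisfiesS R M n := by
  intro p _
  refine le_trans ?_ (WithBot.coe_le_coe.2 (h p))
  rw [WithBot.coe_min]
  exact le_min (min_le_left _ _)
    ((hR p).trans (WithBot.coe_le_coe.2 (depth_localizedModule_self_le p)))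

lemma SatisfiesS.extDepthGE [Module.Finite R M] {n e : ℕ} (h : SatisfiesS R M n) (he : e ≤ n)
    (p : Ideal R) [p.IsPrime] (hp : (e : ℕ∞) ≤ p.height) :
    ExtDepthGE (Localization.AtPrime p) (LocalizedModule p.primeCompl M) e := by
  refine natCast_le_depth_iff.1 (WithBot.coe_le_coe.1 (le_trans (le_min ?_ ?_) (h p)))
  · exact WithBot.coe_le_coe.2 (ENat.natCast_le_natCast.2 he)
  · rw [IsLocalization.AtPrime.ringKrullDim_eq_height p]
    exact WithBot.coe_le_coe.2 hp

end Serre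

/-! ### Finite injective dimension over a local ring -/

section FiniteInjectiveDimension

open scoped Pointwise

variable {A : Type u} [CommRing A] [IsLocalRing A] [IsNoetherianRing A]
  {D N : Type u} [AddCommGroup D] [Module A D] [AddCommGroup N] [Module A N]

lemma length_le_ringKrullDim {rs : List A} (h : RingTheory.Sequence.IsRegular A rs) :
    ((rs.length : ℕ∞) : WithBot ℕ∞) ≤ ringKrullDim A := by
  rw [← ringKrullDim_add_length_eq_ringKrullDim_of_isRegular rs h]
  have : Nontrivial (A ⧸ Ideal.ofList rs) := by
    refine Ideal.Quotient.nontrivial_iff.2 fun htop ↦ h.top_ne_smul ?_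
    rw [htop]
    simp
  exact le_add_of_nonneg_left ringKrullDim_nonneg_of_nontrivial

/-- A maximal regular sequence `rs` of a noetherian local ring: the residue field embeds into the
quotient by `rs`. -/
lemma exists_isRegular_injective_residueField : ∃ rs : List A,
    (∀ r ∈ rs, r ∈ IsLocalRing.maximalIdeal A) ∧ RingTheory.Sequence.IsRegular A rs ∧
      ∃ φ : A ⧸ IsLocalRing.maximalIdeal A →ₗ[A] A ⧸ (Ideal.ofList rs • ⊤ : Submodule A A),
        Function.Injective φ := by
  classical
  let P : ℕ → Prop := fun t ↦ ∃ rs : List A, (∀ r ∈ rs, r ∈ IsLocalRing.maximalIdeal A) ∧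
    RingTheory.Sequence.IsRegular A rs ∧ rs.length = t
  obtain ⟨d, hd⟩ : ∃ d : ℕ, ringKrullDim A < d := by
    have := ringKrullDim_lt_top (R := A)
    generalize ringKrullDim A = k at this
    induction k with
    | bot => exact ⟨0, WithBot.bot_lt_coe _⟩
    | coe k =>
      lift k to ℕ using fun h ↦ by simp [h] at this
      exact ⟨k + 1, by exact_mod_cast Nat.lt_succ_self k⟩
  have hbound : ∀ t, P t → t ≤ d := by
    rintro t ⟨rs, -, h2, rfl⟩
    have := (length_le_ringKrullDim h2).trans hd.le
    exact_mod_cast this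
  have hP0 : P 0 := ⟨[], by simp, .nil _ _, rfl⟩
  obtain ⟨rs, h1, h2, h3⟩ := Nat.findGreatest_spec (P := P) (Nat.zero_le d) hP0
  refine ⟨rs, h1, h2, ?_⟩
  by_contra! hφ
  have : IsSimpleModule A (A ⧸ IsLocalRing.maximalIdeal A) :=
    isSimpleModule_iff_isCoatom.2 (IsLocalRing.maximalIdeal.isMaximal A).out
  have hsub : Subsingleton (A ⧸ IsLocalRing.maximalIdeal A →ₗ[A]
      A ⧸ (Ideal.ofList rs • ⊤ : Submodule A A)) :=
    subsingleton_of_forall_eq 0 fun φ ↦ (LinearMap.injective_or_eq_zero φ).resolve_left (hφ φ)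
  obtain ⟨x, hx, hreg⟩ := IsSMulRegular.subsingleton_linearMap_iff.1 hsub
  rw [Ideal.annihilator_quotient] at hx
  have hmem : ∀ r ∈ rs ++ [x], r ∈ IsLocalRing.maximalIdeal A := by
    intro r hr
    rcases List.mem_append.1 hr with hr | hr
    · exact h1 r hr
    · rwa [List.mem_singleton.1 hr]
  -- With no embedding of the simple module k, Hom(k, A/(rs)) = 0, so some `x` in the maximal ideal
  -- is regular on A/(rs) and lengthens the maximal sequence.
  have hP : P (rs.length + 1) := ⟨rs ++ [x], hmem,
    (IsLocalRing.isRegular_iff_isWeaklyRegular_of_subset_maximalIdeal hmem).2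
      ((RingTheory.Sequence.isWeaklyRegular_append_iff A rs [x]).2
        ⟨h2.1, (RingTheory.Sequence.isWeaklyRegular_singleton_iff _ x).2 hreg⟩), by simp⟩
  have := Nat.le_findGreatest (hbound _ hP) hP
  lia

lemma extVanishes_quotient_ofList {rs : List A} (hrs : ∀ r ∈ rs, r ∈ IsLocalRing.maximalIdeal A)
    (h : RingTheory.Sequence.IsRegular A rs) {i : ℕ} (hi : rs.length < i) :
    ExtVanishes A (A ⧸ (Ideal.ofList rs • ⊤ : Submodule A A)) N i := by
  have hpd := ModuleCat.projectiveDimension_quotient_eq_add_length_of_isWeaklyRegular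
    (ModuleCat.of A A) rs h.1 hrs
  rw [ModuleCat.projectiveDimension_eq_zero_of_projective (ModuleCat.of A A), zero_add] at hpd
  have := (projectiveDimension_le_iff _ _).1 hpd.le
  exact HasProjectiveDimensionLT.subsingleton _ (rs.length + 1) i hi _

/-- A prime filtration reduces N to A/𝔭. For the maximal ideal, the embedding of k into B transfers
vanishing from B to k; for other primes, an element of the maximal ideal outside 𝔭 is regular on A/𝔭
and Nakayama applies. -/
lemma extVanishes_of_extVanishes_succ [Module.Finite A D] [Module.Finite A N] {i : ℕ}
    {B : Type u} [AddCommGroup B] [Module A B] [Module.Finite A B]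
    (φ : A ⧸ IsLocalRing.maximalIdeal A →ₗ[A] B) (hφ : Function.Injective φ)
    (hB : ExtVanishes A B D i)
    (h : ∀ (X : Type u) [AddCommGroup X] [Module A X] [Module.Finite A X],
      ExtVanishes A X D (i + 1)) : ExtVanishes A N D i := by
  refine IsNoetherianRing.induction_on_isQuotientEquivQuotientPrime A (M := N) inferInstance
    (fun N _ _ _ _ ↦ extVanishes_of_subsingleton_left i) (fun N _ _ _ p e ↦ ?_)
    (fun X _ _ _ Y _ _ _ Z _ _ _ f g hf hg hfg hX hZ ↦ extVanishes_middle_left hf hfg hg hX hZ)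
  refine ExtVanishes.congr_left e ?_
  by_cases hp : p.1 = IsLocalRing.maximalIdeal A
  · rw [hp]
    exact extVanishes_sub_left hφ (LinearMap.exact_map_mkQ_range φ) (Submodule.mkQ_surjective _) hB
      (h _)
  · obtain ⟨y, hy, hyp⟩ := SetLike.exists_of_lt
      (lt_of_le_of_ne (IsLocalRing.le_maximalIdeal p.2.ne_top) hp)
    have hreg : IsSMulRegular (A ⧸ p.1) y := by
      rw [isSMulRegular_quotient_iff_mem_of_smul_mem]
      intro x hx
      exact (p.2.mem_or_mem hx).resolve_left hyp
    exact extVanishes_of_extVanishes_quotient_smul hy hreg (exact_lsmul_mkQ y)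
      (Submodule.mkQ_surjective _) (h _)

/-- If `D` has finite injective dimension, then `Ext^i(-, D)` vanishes on finitely generated modules
above the length of some regular sequence of the ring. -/
lemma exists_isRegular_forall_extVanishes [Module.Finite A D]
    (hD : injectiveDimension (ModuleCat.of A D) < ⊤) :
    ∃ rs : List A, RingTheory.Sequence.IsRegular A rs ∧
      ∀ i, rs.length < i → ∀ (X : Type u) [AddCommGroup X] [Module A X] [Module.Finite A X],
        ExtVanishes A X D i := by
  obtain ⟨rs, h1, h2, φ, hφ⟩ := exists_isRegular_injective_residueField (A := A)
  obtain ⟨d, hd⟩ := (injectiveDimension_ne_top_iff _).1 hD.ne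
  refine ⟨rs, h2, ?_⟩
  -- Descending induction on the degree from above the injective dimension bound `d`; `j` is the
  -- remaining distance.
  have key : ∀ j i, d + 1 ≤ i + j → rs.length < i →
      ∀ (X : Type u) [AddCommGroup X] [Module A X] [Module.Finite A X], ExtVanishes A X D i := by
    intro j
    induction j with
    | zero =>
      intro i hi _ X _ _ _
      exact HasInjectiveDimensionLT.subsingleton _ (d + 1) i hi _
    | succ j ih =>
      intro i hi hlt X _ _ _
      exact extVanishes_of_extVanishes_succ φ hφ (extVanishes_quotient_ofList h1 h2 hlt)
        (ih (i + 1) (by lia) (by lia))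
  exact fun i hi ↦ key (d + 1) i (by lia) hi

/-- Each regular element on N lowers by one, through Nakayama, the degree from which Ext into D
vanishes. -/
lemma extVanishes_of_isWeaklyRegular [Module.Finite A D] {t : ℕ}
    (hD : ∀ i, t < i → ∀ (X : Type u) [AddCommGroup X] [Module A X] [Module.Finite A X],
      ExtVanishes A X D i) [Module.Finite A N] {rs : List A}
    (hrs : ∀ r ∈ rs, r ∈ IsLocalRing.maximalIdeal A)
    (h : RingTheory.Sequence.IsWeaklyRegular N rs) {i : ℕ} (hi : t < i + rs.length) :
    ExtVanishes A N D i := by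
  induction rs generalizing N i with
  | nil => exact hD i hi N
  | cons r rs ih =>
    rw [RingTheory.Sequence.isWeaklyRegular_cons_iff] at h
    rw [List.forall_mem_cons] at hrs
    exact extVanishes_of_extVanishes_quotient_smul hrs.1 h.1 (exact_lsmul_mkQ r)
      (Submodule.mkQ_surjective _) (ih hrs.2 h.2 (by rw [List.length_cons] at hi; lia))

end FiniteInjectiveDimension

/-! ### Total reflexivity of modules of maximal depth -/

section MaximalCohenMacaulay

variable {A : Type u} [CommRing A] [IsNoetherianRing A]
  {D N : Type u} [AddCommGroup D] [Module A D] [AddCommGroup N] [Module A N]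

lemma extVanishes_dual_of_extVanishes (hC : IsSemidualizing A D) {t : ℕ}
    (hD : ∀ i, t < i → ∀ (X : Type u) [AddCommGroup X] [Module A X] [Module.Finite A X],
      ExtVanishes A X D i) [Module.Finite A N] (hN : ∀ i, 0 < i → ExtVanishes A N D i)
    {i : ℕ} (hi : 0 < i) : ExtVanishes A (N →ₗ[A] D) D i := by
  have := hC.finite
  -- Passing to a syzygy of N raises the degree by one on the dual side; after `j` syzygies it
  -- exceeds `t`.
  suffices key : ∀ j i, 0 < i → t < i + j → ∀ (N : Type u) [AddCommGroup N] [Module A N]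
      [Module.Finite A N], (∀ i, 0 < i → ExtVanishes A N D i) →
      ExtVanishes A (N →ₗ[A] D) D i from key t i hi (by lia) N hN
  intro j
  induction j with
  | zero => exact fun i _ hi N _ _ _ _ ↦ hD i hi _
  | succ j ih =>
    intro i hi hij N _ _ _ hN
    obtain ⟨m, g, hg⟩ := Module.Finite.exists_fin' A N
    have hinj := (LinearMap.ker g).injective_subtype
    have hex := LinearMap.exact_subtype_ker_map g
    refine (extVanishes_dual_iff_succ hC.isTotallyReflexive_of_projective
      (surjective_cDualMap_of_extVanishes hinj hex hg (hN 1 one_pos)) hex hg hi).2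
      (ih (i + 1) (by lia) (by lia) _ fun k hk ↦ ?_)
    exact extVanishes_sub_left hinj hex hg (extVanishes_of_projective hk) (hN _ (Nat.succ_pos k))

/-- The hypothesis passes to the first syzygy K. Surjectivity of λ_N is Ext¹(K†, D) = 0, and
injectivity of λ_N is surjectivity of λ_K. -/
lemma isTotallyReflexive_of_extVanishes (hC : IsSemidualizing A D) {t : ℕ}
    (hD : ∀ i, t < i → ∀ (X : Type u) [AddCommGroup X] [Module A X] [Module.Finite A X],
      ExtVanishes A X D i) [Module.Finite A N] (hN : ∀ i, 0 < i → ExtVanishes A N D i) :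
    IsTotallyReflexive A D N := by
  have aux : ∀ (N : Type u) [AddCommGroup N] [Module A N] [Module.Finite A N],
      (∀ i, 0 < i → ExtVanishes A N D i) → ∃ m, ∃ g : (Fin m → A) →ₗ[A] N,
        Function.Surjective g ∧ Function.Surjective (cDualMap D (LinearMap.ker g).subtype) ∧
        ∀ i, 0 < i → ExtVanishes A (LinearMap.ker g) D i := by
    intro N _ _ _ hN
    obtain ⟨m, g, hg⟩ := Module.Finite.exists_fin' A N
    have hinj := (LinearMap.ker g).injective_subtype
    have hex := LinearMap.exact_subtype_ker_map g
    exact ⟨m, g, hg, surjective_cDualMap_of_extVanishes hinj hex hg (hN 1 one_pos), fun i hi ↦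
      extVanishes_sub_left hinj hex hg (extVanishes_of_projective hi) (hN _ (Nat.succ_pos i))⟩
  have hsurj : ∀ (N : Type u) [AddCommGroup N] [Module A N] [Module.Finite A N],
      (∀ i, 0 < i → ExtVanishes A N D i) → Function.Surjective (biduality A D N) := by
    intro N _ _ _ hN
    obtain ⟨m, g, hg, hd, hK⟩ := aux N hN
    exact (surjective_biduality_iff_extVanishes_one hC.isTotallyReflexive_of_projective hd
      (LinearMap.exact_subtype_ker_map g) hg).2 (extVanishes_dual_of_extVanishes hC hD hK one_pos)
  refine ⟨⟨?_, hsurj N hN⟩, hN, fun i hi ↦ extVanishes_dual_of_extVanishes hC hD hN hi⟩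
  obtain ⟨m, g, hg, hd, hK⟩ := aux N hN
  exact (injective_biduality_iff_surjective_biduality hC.isTotallyReflexive_of_projective hd
    (LinearMap.exact_subtype_ker_map g) hg).2 (hsurj _ hK)

/-- Over a local ring, if a semidualizing module `D` has finite injective dimension, then every
module of depth at least the dimension of the ring is totally `D`-reflexive. -/
lemma isTotallyReflexive_of_ringKrullDim_le_depth [IsLocalRing A] (hC : IsSemidualizing A D)
    (hD : injectiveDimension (ModuleCat.of A D) < ⊤) [Module.Finite A N]
    (hN : ringKrullDim A ≤ (depth A N : WithBot ℕ∞)) : IsTotallyReflexive A D N := by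
  have := hC.finite
  obtain ⟨rs, hrs, hvan⟩ := exists_isRegular_forall_extVanishes hD
  refine isTotallyReflexive_of_extVanishes hC hvan fun i hi ↦ ?_
  rcases subsingleton_or_nontrivial N with hs | hn
  · exact extVanishes_of_subsingleton_left i
  obtain ⟨ys, h1, h2, h3⟩ := exists_isRegular_of_le_depth
    (WithBot.coe_le_coe.1 ((length_le_ringKrullDim hrs).trans hN))
  exact extVanishes_of_isWeaklyRegular hvan h1 h2.1 (by lia)

end MaximalCohenMacaulay

/-! ### From Serre's condition to torsionfreeness -/

section Main

variable {R : Type u} [CommRing R] {C M : Type u} [AddCommGroup C] [Module R C]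
  [AddCommGroup M] [Module R M]

lemma mk_one_ne_zero_of_colon {X : Type u} [AddCommGroup X] [Module R X] {p : Ideal R}
    [p.IsPrime] {x : X} (hx : ∀ a, a • x = 0 → a ∈ p) :
    (LocalizedModule.mk x 1 : LocalizedModule p.primeCompl X) ≠ 0 := by
  intro h
  rw [← LocalizedModule.zero_mk 1, LocalizedModule.mk_eq] at h
  obtain ⟨u, hu⟩ := h
  rw [smul_zero, smul_zero, one_smul] at hu
  exact u.2 (hx u hu)

lemma smul_mk_eq_zero_of_mem_maximalIdeal {X : Type u} [AddCommGroup X] [Module R X]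
    {p : Ideal R} [p.IsPrime] {x : X} (hx : ∀ a ∈ p, a • x = 0) {a : Localization.AtPrime p}
    (ha : a ∈ IsLocalRing.maximalIdeal (Localization.AtPrime p)) :
    a • (LocalizedModule.mk x 1 : LocalizedModule p.primeCompl X) = 0 := by
  induction a using Localization.induction_on with
  | H y =>
    rw [Localization.mk_eq_mk', IsLocalization.AtPrime.mk'_mem_maximal_iff _ p] at ha
    rw [LocalizedModule.mk_smul_mk, hx _ ha, LocalizedModule.zero_mk]

variable [IsNoetherianRing R]

/-- A map `f : M → Y` is injective if, at every prime, either its localization is injective or the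
localization of `M` has positive depth. -/
lemma injective_of_localizedModule [Module.Finite R M] {Y : Type u} [AddCommGroup Y] [Module R Y]
    {f : M →ₗ[R] Y}
    (h : ∀ (p : Ideal R) [p.IsPrime], Function.Injective (LocalizedModule.map p.primeCompl f) ∨
      ExtDepthGE (Localization.AtPrime p) (LocalizedModule p.primeCompl M) 1) :
    Function.Injective f := by
  rw [injective_iff_map_eq_zero]
  by_contra! hne
  obtain ⟨y, hy, hy0⟩ := hne
  have : Nontrivial (LinearMap.ker f) :=
    ⟨⟨⟨y, hy⟩, 0, fun h ↦ hy0 (congrArg Subtype.val h)⟩⟩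
  -- An element `x` of the kernel with annihilator `p` stays nonzero at `p`, yet is killed there
  -- both by the localized f and by the maximal ideal, against either alternative.
  obtain ⟨p, hp⟩ := associatedPrimes.nonempty R (LinearMap.ker f)
  obtain ⟨hprime, x, hx⟩ := isAssociatedPrime_iff.1 hp
  have hx' : ∀ a, a ∈ p ↔ a • (x : M) = 0 := by
    intro a
    rw [hx, Submodule.mem_colon_singleton, Submodule.mem_bot, Subtype.ext_iff]
    rfl
  have hne := mk_one_ne_zero_of_colon (p := p) (x := (x : M)) fun a ↦ (hx' a).2
  rcases h p with h | h
  · refine hne (h ?_)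
    rw [LocalizedModule.map_mk, LinearMap.mem_ker.1 x.2, LocalizedModule.zero_mk, map_zero]
  · exact hne (h.eq_zero_of_smul_eq_zero le_rfl fun a ha ↦
      smul_mk_eq_zero_of_mem_maximalIdeal (fun b hb ↦ (hx' b).1 hb) ha)

/-- Induction on `s` by pushing forward. The height threshold `n` stays fixed while `s`, the depth
required of the module above it, drops by one with each cokernel. -/
lemma isBidualTorsionfree_of_localizedModule (hC : IsSemidualizing R C) {n s : ℕ} (hs : s ≤ n)
    (hCdepth : ∀ (p : Ideal R) [p.IsPrime], (n : ℕ∞) ≤ p.height →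
      ExtDepthGE (Localization.AtPrime p) (LocalizedModule p.primeCompl C) n)
    [Module.Finite R M]
    (hrefl : ∀ (p : Ideal R) [p.IsPrime], p.height < (n : ℕ∞) →
      IsTotallyReflexive (Localization.AtPrime p) (LocalizedModule p.primeCompl C)
        (LocalizedModule p.primeCompl M))
    (hdepth : ∀ (p : Ideal R) [p.IsPrime], (n : ℕ∞) ≤ p.height →
      ExtDepthGE (Localization.AtPrime p) (LocalizedModule p.primeCompl M) s) :
    IsBidualTorsionfree R C M s := by
  induction s generalizing M with
  | zero =>
    exact ⟨fun h ↦ absurd h (by lia), fun h ↦ absurd h (by lia), fun _ _ h ↦ absurd h (by lia)⟩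
  | succ s ih =>
    have := hC.finite
    have := Module.finitePresentation_of_finite R M
    obtain ⟨m, f, hfd⟩ := exists_surjective_cDualMap (R := R) (C := C) (M := M)
    have hsum : IsAddSummand R C (Fin m → C) := isAddSummand_pi m
    have hfg := LinearMap.exact_map_mkQ_range f
    have hg := (LinearMap.range f).mkQ_surjective
    have hsum' : ∀ (p : Ideal R) [p.IsPrime], IsAddSummand (Localization.AtPrime p)
      (LocalizedModule p.primeCompl C) (LocalizedModule p.primeCompl (Fin m → C)) :=
        fun p _ ↦ hsum.localizedModule p.primeCompl
    have hY' : ∀ (p : Ideal R) [p.IsPrime], IsTotallyReflexive (Localization.AtPrime p)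
      (LocalizedModule p.primeCompl C) (LocalizedModule p.primeCompl (Fin m → C)) := fun p _ ↦
        (hC.localizedModule p.primeCompl).isTotallyReflexive_of_isAddSummand (hsum' p)
    have hfd' : ∀ (p : Ideal R) [p.IsPrime], Function.Surjective
      (cDualMap (LocalizedModule p.primeCompl C) (LocalizedModule.map p.primeCompl f)) :=
        fun p _ ↦ surjective_cDualMap_localizedModule p.primeCompl hfd
    have hf : Function.Injective f := by
      refine injective_of_localizedModule fun p _ ↦ ?_
      rcases lt_or_ge p.height (n : ℕ∞) with hp | hp
      · exact Or.inl ((injective_biduality_iff_of_surjective_cDualMap (hfd' p)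
          (hY' p).biduality_bijective.1).1 (hrefl p hp).biduality_bijective.1)
      · exact Or.inr ((hdepth p hp).mono (by lia))
    refine (isBidualTorsionfree_succ_iff (hC.isTotallyReflexive_of_isAddSummand hsum) hfd hf hfg
      hg s).2 (ih (by lia) (fun p _ hp ↦ ?_) fun p _ hp ↦ ?_)
    · exact (hY' p).quotient (hfd' p) (localizedModule_map_injective _ hf)
        (localizedModule_map_exact _ hfg) (LocalizedModule.map_surjective _ _ hg) (hrefl p hp)
    -- C^m has depth at least n ≥ s + 1 here, so by the depth lemma the cokernel keeps depth at
    -- least `s`.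
    · exact (((hCdepth p hp).of_isAddSummand (hsum' p)).mono (by lia)).quotient
        (localizedModule_map_injective _ hf) (localizedModule_map_exact _ hfg)
        (LocalizedModule.map_surjective _ _ hg) (hdepth p hp)

end Main

end RelTorsionfree

theorem theorem1p1 {R : Type u} [CommRing R] [IsNoetherianRing R]
    (C : Type u) [AddCommGroup C] [Module R C] (hC : RelTorsionfree.IsSemidualizing R C)
    (M : Type u) [AddCommGroup M] [Module R M] [Module.Finite R M]
    (n : ℕ) (hn : 1 ≤ n)
    (hS : RelTorsionfree.SatisfiesS R R n)
    (h : RelTorsionfree.SatisfiesG R C (n - 1) ∨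
      ∀ (p : Ideal R) [p.IsPrime], p.height < (n : ℕ∞) →
        RelTorsionfree.IsTotallyReflexive (Localization.AtPrime p)
          (LocalizedModule p.primeCompl C) (LocalizedModule p.primeCompl M)) :
    List.TFAE [
      RelTorsionfree.IsTorsionfree R C M n,
      RelTorsionfree.HasUniversalPushforward R C M n,
      RelTorsionfree.IsSyzygy R C M n,
      RelTorsionfree.SatisfiesSTilde R M n,
      RelTorsionfree.SatisfiesS R M n] := by
  tfae_have 1 → 2 := fun h1 ↦
    ((RelTorsionfree.isTorsionfree_iff_isBidualTorsionfree hC n).1 h1).hasUniversalPushforward hC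
  tfae_have 2 → 3 := fun ⟨σ, _⟩ ↦ ⟨σ⟩
  tfae_have 3 → 4 := fun h3 ↦ h3.satisfiesSTilde hC
  tfae_have 4 → 5 := fun h4 ↦ h4.satisfiesS hS
  tfae_have 5 → 1 := by
    intro h5
    refine (RelTorsionfree.isTorsionfree_iff_isBidualTorsionfree hC n).2
      (RelTorsionfree.isBidualTorsionfree_of_localizedModule hC le_rfl (fun p _ hp ↦ ?_)
        (fun p _ hp ↦ ?_) fun p _ hp ↦ h5.extDepthGE le_rfl p hp)
    · refine (hC.localizedModule p.primeCompl).extDepthGE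
        (le_trans ?_ (RelTorsionfree.depth_localizedModule_self_le p))
      exact RelTorsionfree.natCast_le_depth_iff.2 (hS.extDepthGE le_rfl p hp)
    -- At height less than n the minimum in (S_n) is the dimension, so M_𝔭 has depth at least dim
    -- R_𝔭; and height less than n means at most n - 1, since n ≥ 1.
    · rcases h with hG | hrefl
      · refine RelTorsionfree.isTotallyReflexive_of_ringKrullDim_le_depth
          (hC.localizedModule p.primeCompl) (hG p ?_) (le_trans (le_min ?_ le_rfl) (h5 p))
        · rw [← Nat.sub_add_cancel hn] at hp
          exact ENat.lt_natCast_add_one_iff.1 (by exact_mod_cast hp)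
        · rw [IsLocalization.AtPrime.ringKrullDim_eq_height p]
          exact WithBot.coe_le_coe.2 hp.le
      · exact hrefl p hp
  tfae_finish
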